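/- Let $\mathbb F_q$ be a finite field, $\overline{\mathbb F}_q$ an algebraic closure of it, and $\mathbb A^t=\overline{\mathbb F}_q^{\,t}$. Let $t,n,k,d_1,\dots,d_t$ be positive integers with $1\le k\le n$, $d_1>\cdots>d_t\ge 2$, and $\mathrm{char}(\mathbb F_q)\nmid d_i$ for $1\le i\le t$. Let $g_1,\dots,g_n\in\mathbb F_q[X_1,\dots,X_k]$, and let $A=(a_{ji})\in\mathbb F_q^{n\times t}$ be a matrix all of whose $n\times n$ submatrices have rank $n$. Put $$f_j:=a_{j1}X_1^{d_1}+\cdots+a_{jt}X_t^{d_t}-g_j\in\mathbb F_q[X_1,\dots,X_t]\quad(1\le j\le n),\qquad V:=V(f_1,\dots,f_n)\subset\mathbb A^t .$$ Assume that either * $g_j\in\mathbb F_q$ for all $j$, and $n\le t-2$; or * $\deg g_j<d_t$ for all $j$, $\deg g_j>0$ for at least one $j$, and $n\le (t-1)/2$. Let $\mathbb K$ be a field with $\mathbb F_q\subseteq\mathbb K\subseteq\overline{\mathbb F}_q$ (for example $\mathbb K=\mathbb F_q$ or $\mathbb K=\overline{\mathbb F}_q$), over which all notions below are taken. The dimension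 of a subset of $\mathbb A^t$ is the supremum of the lengths of chains of nonempty irreducible $\mathbb K$-varieties contained in it. The degree of an irreducible $\mathbb K$-variety $C$ is the maximum of $|C\cap L|$ over the affine linear subspaces $L\subseteq\mathbb A^t$ of codimension $\dim C$ with $C\cap L$ finite, and the degree of a $\mathbb K$-variety is the sum of the degrees of its irreducible $\mathbb K$-components. A point $x\in V$ is singular if the tangent space of $V$ at $x$ (the kernel of the Jacobian matrix at $x$ of generators of the defining ideal $I(V)\subseteq\mathbb K[X_1,\dots,X_t]$) has a dimension different from the maximal dimension of the irreducible components of $V$ through $x$. Then: 1. the ideal $(f_1,\dots,f_n)\subseteq\mathbb K[X_1,\dots,X_t]$ is radical; 2. the singular locus of $V$ has codimension at least $2$ in $V$, that is, it is empty or $\dim V-\dim\mathrm{Sing}(V)\ge 2$; 3. $V$ is a complete intersection of codimension $n$: it is the zero set of a regular sequence of $n$ polynomials, it has pure dimension $t-n$, and its defining ideal $I(V)$ is generated by $n$ polynomials; 4. there is an invertible matrix $M\in\mathbb F_q^{n\times n}$ such that $MA$ is in row echelon form with $n$ pivots, and whenever $MA$ ($M$ invertible) is in row echelon form with pivots in the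 columns $i_1<\cdots<i_n$, one has $\deg V\le d_{i_1}\cdots d_{i_n}$. -/

import Mathlib

noncomputable section

namespace DiagonalSystem

section Geometry

/-! Affine varieties in `Ω^σ`, defined over a subfield `K` of an algebraically closed field `Ω`. -/

variable (K : Type*) [Field K] {Ω : Type*} [Field Ω] [Algebra K Ω]
variable {σ : Type*} [Fintype σ]

/-- `W ⊆ Ω^σ` is an affine `K`-variety: the set of common zeros in `Ω^σ` of polynomials
with coefficients in `K`. -/
def IsVariety (W : Set (σ → Ω)) : Prop :=
  ∃ I : Ideal (MvPolynomial σ K), W = MvPolynomial.zeroLocus Ω I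

/-- `W` is a (nonempty) irreducible `K`-variety. -/
def IsIrredVariety (W : Set (σ → Ω)) : Prop :=
  IsVariety K W ∧ W.Nonempty ∧
    ∀ W₁ W₂ : Set (σ → Ω), IsVariety K W₁ → IsVariety K W₂ → W = W₁ ∪ W₂ → W₁ = W ∨ W₂ = W

/-- The irreducible `K`-components of `V`: the maximal irreducible `K`-varieties in `V`. -/
def components (V : Set (σ → Ω)) : Set (Set (σ → Ω)) :=
  {C | Maximal (fun W => IsIrredVariety K W ∧ W ⊆ V) C}

/-- The dimension of `V`: the supremum of the lengths `m` of chains `V₀ ⊂ V₁ ⊂ ⋯ ⊂ Vₘ` of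
irreducible `K`-varieties contained in `V` (it is `⊥` if `V` is empty). -/
def dim (V : Set (σ → Ω)) : WithBot ℕ∞ :=
  Order.krullDim {W : Set (σ → Ω) // IsIrredVariety K W ∧ W ⊆ V}

/-- The dimension of `V` at `x`: the maximum of the dimensions of the irreducible
`K`-components of `V` that contain `x`. -/
def dimAt (V : Set (σ → Ω)) (x : σ → Ω) : WithBot ℕ∞ :=
  ⨆ C ∈ {C ∈ components K V | x ∈ C}, dim K C

/-- The tangent space of `V` at a point `x ∈ V`: the vectors annihilated by the differentials
at `x` of all polynomials of the defining ideal `I(V) ⊆ K[X]`. For `x ∈ V` this is the kernel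
of the Jacobian matrix at `x` of any system of generators of `I(V)`. -/
def tangentSpace (V : Set (σ → Ω)) (x : σ → Ω) : Submodule Ω (σ → Ω) where
  carrier := {v | ∀ F ∈ MvPolynomial.vanishingIdeal K V,
    ∑ i, MvPolynomial.aeval x (MvPolynomial.pderiv i F) * v i = 0}
  zero_mem' := by intro F _; simp
  add_mem' := by
    intro v w hv hw F hF
    simp only [Pi.add_apply, mul_add, Finset.sum_add_distrib, hv F hF, hw F hF, add_zero]
  smul_mem' := by
    intro c v hv F hF
    have h : ∀ i, MvPolynomial.aeval x (MvPolynomial.pderiv i F) * (c • v) i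
        = c * (MvPolynomial.aeval x (MvPolynomial.pderiv i F) * v i) := by
      intro i
      simp only [Pi.smul_apply, smul_eq_mul]
      ring
    simp only [h, ← Finset.mul_sum, hv F hF, mul_zero]

/-- The singular locus of `V`: the points `x ∈ V` at which the dimension of the tangent space
differs from the dimension of `V` at `x`. -/
def singularLocus (V : Set (σ → Ω)) : Set (σ → Ω) :=
  {x ∈ V | (Module.finrank Ω (tangentSpace K V x) : WithBot ℕ∞) ≠ dimAt K V x}

/-- The degree of an irreducible `K`-variety `C ⊆ Ω^σ`: the supremum of `|C ∩ L|` over all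
affine linear subspaces `L` of `Ω^σ` of codimension `dim C` for which `C ∩ L` is finite. -/
def degIrred (C : Set (σ → Ω)) : ℕ∞ :=
  ⨆ L ∈ {L : AffineSubspace Ω (σ → Ω) |
    (Module.finrank Ω L.direction : WithBot ℕ∞) + dim K C = (Fintype.card σ : WithBot ℕ∞) ∧
      (C ∩ (L : Set (σ → Ω))).Finite},
    (C ∩ (L : Set (σ → Ω))).encard

/-- The degree of a `K`-variety: the sum of the degrees of its irreducible `K`-components.
The sum is written as the supremum of its finite partial sums, so that no convention about
infinite sums is involved. -/
def deg (V : Set (σ → Ω)) : ℕ∞ :=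
  ⨆ S ∈ {S : Finset (Set (σ → Ω)) | (S : Set (Set (σ → Ω))) ⊆ components K V},
    ∑ C ∈ S, degIrred K C

/-- `V ⊆ Ω^σ` is an (ideal-theoretic) complete intersection of codimension `m` over `K`: it is
the zero set of a regular sequence of length `m` in `K[X]`, it has pure dimension `|σ| - m`, and
its defining ideal `I(V) ⊆ K[X]` is generated by `m` polynomials. -/
def IsCompleteIntersection (V : Set (σ → Ω)) (m : ℕ) : Prop :=
  (∃ F : Fin m → MvPolynomial σ K,
    RingTheory.Sequence.IsRegular (MvPolynomial σ K) (List.ofFn F) ∧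
      V = MvPolynomial.zeroLocus Ω (Ideal.span (Set.range F))) ∧
  (∀ C ∈ components K V, dim K C + (m : WithBot ℕ∞) = (Fintype.card σ : WithBot ℕ∞)) ∧
  ∃ G : Fin m → MvPolynomial σ K,
    MvPolynomial.vanishingIdeal K V = Ideal.span (Set.range G)

end Geometry

section System

variable {F : Type*} [Field F] {n t : ℕ}

/-- Hypothesis (H): every `n × n` submatrix of the `n × t` matrix `A` has rank `n`. -/
def HypH (A : Matrix (Fin n) (Fin t) F) : Prop :=
  ∀ e : Fin n ↪o Fin t, (A.submatrix id e).rank = n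

/-- The matrix `B` is in row echelon form, with no zero row, and `i 0 < ⋯ < i (n-1)` are the
indices of the columns of its pivots. -/
def IsRowEchelon (B : Matrix (Fin n) (Fin t) F) (i : Fin n → Fin t) : Prop :=
  StrictMono i ∧ ∀ j, B j (i j) ≠ 0 ∧ ∀ l, l < i j → B j l = 0

/-- The polynomials `f_j = a_{j1} X_1^{d_1} + ⋯ + a_{jt} X_t^{d_t} - g_j`. -/
def sysPoly (A : Matrix (Fin n) (Fin t) F) (d : Fin t → ℕ)
    (g : Fin n → MvPolynomial (Fin t) F) (j : Fin n) : MvPolynomial (Fin t) F :=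
  ∑ i, MvPolynomial.C (A j i) * MvPolynomial.X i ^ d i - g j

/-- The ideal `(f_1, …, f_n)` in the polynomial ring over an extension `K` of `F`. -/
def sysIdeal (K : Type*) [Field K] [Algebra F K] (A : Matrix (Fin n) (Fin t) F) (d : Fin t → ℕ)
    (g : Fin n → MvPolynomial (Fin t) F) : Ideal (MvPolynomial (Fin t) K) :=
  Ideal.span (Set.range fun j => MvPolynomial.map (algebraMap F K) (sysPoly A d g j))

/-- The affine variety `V = V(f_1, …, f_n) ⊆ Ω^t`. -/
def sysVariety (Ω : Type*) [Field Ω] [Algebra F Ω] (A : Matrix (Fin n) (Fin t) F)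
    (d : Fin t → ℕ) (g : Fin n → MvPolynomial (Fin t) F) : Set (Fin t → Ω) :=
  {x | ∀ j, MvPolynomial.aeval x (sysPoly A d g j) = 0}

end System

end DiagonalSystem

end

set_option linter.unusedSectionVars false

noncomputable section

/-! By (H) every `n × n` block of `A` is invertible, so for each set `S` of `n` indices the system
is equivalent to `X_i^{d_i} = u_i`, `i ∈ S`, with `u_i = b_i - ∑_{j ∉ S} c_{ij} X_j^{d_j}`, all
`c_{ij} ≠ 0`, and `b_i` a combination of the `g_j` (`HypH.exists_solvedPoly`). Each claim follows
from a suitable choice of `S` and of a weight for which `X_i^{d_i}` is the leading monomial of the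
`i`-th equation: the indicator of `S` works for every `S`, and total degree works for the first `n`
indices because `d` decreases.

For such a triangular system the linear map `divMap`, which replaces each `X_i^{d_i}` by `f_i`, is
the identity plus terms of lower weight, hence bijective, and it carries the monomial ideal
`(X_i^{d_i})` onto `(f_i)`. Division with remainder, the regular sequence property, and regularity
of nonzero polynomials in the free variables (those outside `S`) modulo the ideal reduce to
statements about monomials. The quotient is thus finite over the polynomial ring in the `t - n` free
variables, which embeds modulo each minimal prime: the dimension is pure.

Radicality: take `S` among the variables absent from the `g_j`, so that each `u_i` is a nonzero
polynomial in the free variables. Over a point where no `u_i` vanishes the fibre is a grid of `∏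
d_i` points. A remainder of degree `< d_i` in each `X_i` that vanishes on `V` is zero on these
fibres, hence zero.

Singular locus: the Jacobian columns of index `≥ k` are those of `A` scaled by `d_i x_i^{d_i - 1}`.
By (H) a singular point has fewer than `n` nonzero coordinates among them, so at least `t + 1 - n -
k` of them vanish. Adjoining that many equations `X_i = 0` to a solved system leaves it triangular
with `k - 1` free variables.

Degree: take finite linear sections of the components, with `N` points in all. Monomials of degree
`≤ s` in the linear forms, times polynomials separating the points and components, are independent
modulo the ideal (`IsSlice.eq_zero`). Comparison with the reduced monomials gives `N B(s) ≤ (∏ d_i)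
B(s + M)` for all `s`, where `B` grows polynomially, hence `N ≤ ∏ d_i`. By (H) the pivots are always
the first `n` columns. -/

namespace DiagonalSystem

open MvPolynomial

/-! ### Triangular systems: polynomials `f i` with leading monomial `X i ^ d i` -/

section Triangular

variable {K : Type*} [Field K] {σ : Type*} [Fintype σ] {w : σ → ℕ}

/-- The polynomials all of whose monomials have `w`-weight less than `N`. -/
def weightLT (K : Type*) [Field K] (w : σ → ℕ) (N : ℕ) : Submodule K (MvPolynomial σ K) :=
  restrictSupport K {e | Finsupp.weight w e < N}

theorem mem_weightLT {N : ℕ} {p : MvPolynomial σ K} :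
    p ∈ weightLT K w N ↔ ∀ e ∈ p.support, Finsupp.weight w e < N :=
  Iff.rfl

theorem weightLT_mono {M N : ℕ} (h : M ≤ N) : weightLT K w M ≤ weightLT K w N :=
  fun _ hp _ he => (hp he).trans_le h

theorem exists_mem_weightLT (w : σ → ℕ) (p : MvPolynomial σ K) : ∃ N, p ∈ weightLT K w N :=
  ⟨p.support.sup (Finsupp.weight w) + 1, mem_weightLT.2 fun _ he =>
    Nat.lt_succ_of_le (Finset.le_sup (f := Finsupp.weight w) he)⟩

theorem mul_mem_weightLT {a b : ℕ} {p q : MvPolynomial σ K} (hp : p ∈ weightLT K w (a + 1))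
    (hq : q ∈ weightLT K w b) : p * q ∈ weightLT K w (a + b) := by
  classical
  rw [mem_weightLT] at *
  intro e he
  obtain ⟨x, hx, y, hy, rfl⟩ := Finset.mem_add.1 (support_mul p q he)
  have := hp x hx
  have := hq y hy
  rw [map_add]
  omega

/-- `p` is the monic monomial with exponent `e` plus terms of smaller weight. -/
def HasLead (w : σ → ℕ) (p : MvPolynomial σ K) (e : σ →₀ ℕ) : Prop :=
  p - monomial e 1 ∈ weightLT K w (Finsupp.weight w e)

theorem hasLead_monomial (e : σ →₀ ℕ) : HasLead w (monomial e (1 : K)) e := by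
  simp [HasLead]

theorem monomial_mem_weightLT (e : σ →₀ ℕ) (c : K) :
    monomial e c ∈ weightLT K w (Finsupp.weight w e + 1) := by
  classical
  rw [mem_weightLT]
  intro e' he'
  rw [Finset.mem_singleton.1 (support_monomial_subset he')]
  exact Nat.lt_succ_self _

theorem HasLead.mem_weightLT {p : MvPolynomial σ K} {e : σ →₀ ℕ} (h : HasLead w p e) :
    p ∈ weightLT K w (Finsupp.weight w e + 1) := by
  rw [← sub_add_cancel p (monomial e 1)]
  exact add_mem (weightLT_mono (Nat.le_succ _) h) (monomial_mem_weightLT e 1)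

theorem HasLead.mul {p q : MvPolynomial σ K} {e e' : σ →₀ ℕ} (hp : HasLead w p e)
    (hq : HasLead w q e') : HasLead w (p * q) (e + e') := by
  have : p * q - monomial (e + e') 1 =
      p * (q - monomial e' 1) + monomial e' 1 * (p - monomial e 1) := by
    rw [show (monomial (e + e') (1 : K)) = monomial e 1 * monomial e' 1 by
      rw [monomial_mul, one_mul]]
    ring
  rw [HasLead, this, map_add]
  refine add_mem (mul_mem_weightLT hp.mem_weightLT hq) ?_
  rw [add_comm]
  exact mul_mem_weightLT (monomial_mem_weightLT e' 1) hp

theorem hasLead_one : HasLead w (1 : MvPolynomial σ K) 0 := hasLead_monomial 0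

theorem HasLead.pow {p : MvPolynomial σ K} {e : σ →₀ ℕ} (hp : HasLead w p e) (n : ℕ) :
    HasLead w (p ^ n) (n • e) := by
  induction n with
  | zero => simpa using hasLead_one
  | succ n ih => rw [pow_succ, succ_nsmul]; exact ih.mul hp

theorem HasLead.prod {ι : Type*} (s : Finset ι) {p : ι → MvPolynomial σ K} {e : ι → σ →₀ ℕ}
    (h : ∀ i ∈ s, HasLead w (p i) (e i)) : HasLead w (∏ i ∈ s, p i) (∑ i ∈ s, e i) := by
  classical
  induction s using Finset.induction_on with
  | empty => simpa using hasLead_one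
  | insert a s ha ih =>
    rw [Finset.prod_insert ha, Finset.sum_insert ha]
    exact (h a (Finset.mem_insert_self a s)).mul
      (ih fun i hi => h i (Finset.mem_insert_of_mem hi))

variable [DecidableEq σ]

/-- For `i ∈ S`, the polynomial `f i` has leading monomial `X i ^ d i`, with `0 < d i`. -/
def IsTriangular (w : σ → ℕ) (S : Finset σ) (d : σ → ℕ) (f : σ → MvPolynomial σ K) : Prop :=
  ∀ i ∈ S, 0 < d i ∧ HasLead w (f i) (Finsupp.single i (d i))

variable (S : Finset σ) (d : σ → ℕ) (f : σ → MvPolynomial σ K)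

/-- The factor `f i ^ (n / d i) * X i ^ (n % d i)` for `i ∈ S`, and `X i ^ n` for `i ∉ S`. -/
def divPow (i : σ) (n : ℕ) : MvPolynomial σ K :=
  if i ∈ S then f i ^ (n / d i) * X i ^ (n % d i) else X i ^ n

/-- The product of the factors `divPow`: a polynomial with leading exponent `e`. -/
def divMonomial (e : σ →₀ ℕ) : MvPolynomial σ K := ∏ i, divPow S d f i (e i)

/-- The linear map sending the monomial with exponent `e` to `divMonomial S d f e`. -/
def divMap : MvPolynomial σ K →ₗ[K] MvPolynomial σ K :=
  (basisMonomials σ K).constr K (divMonomial S d f)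

/-- The span of the monomials divisible by `X i ^ d i` for some `i ∈ S`. -/
def monomialMultiples (K : Type*) [Field K] : Submodule K (MvPolynomial σ K) :=
  restrictSupport K {e | ∃ i ∈ S, d i ≤ e i}

/-- A polynomial is reduced if `e i < d i` for all its exponents `e` and all `i ∈ S`. -/
def IsReducedPoly (p : MvPolynomial σ K) : Prop := ∀ e ∈ p.support, ∀ i ∈ S, e i < d i

variable {S d f}

theorem divMap_monomial (e : σ →₀ ℕ) (c : K) :
    divMap S d f (monomial e c) = c • divMonomial S d f e := by
  have h : monomial e c = c • basisMonomials σ K e := by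
    rw [coe_basisMonomials, smul_monomial, smul_eq_mul, mul_one]
  rw [h, map_smul, divMap, Module.Basis.constr_basis]

theorem hasLead_divMonomial (hf : IsTriangular w S d f) (e : σ →₀ ℕ) :
    HasLead w (divMonomial S d f e) e := by
  have h : HasLead w (∏ i, divPow S d f i (e i)) (∑ i, Finsupp.single i (e i)) := by
    refine HasLead.prod _ fun i _ => ?_
    unfold divPow
    split_ifs with hi
    · obtain ⟨hd, hl⟩ := hf i hi
      have := (hl.pow (e i / d i)).mul (hasLead_monomial (K := K) (Finsupp.single i (e i % d i)))
      rwa [← X_pow_eq_monomial, Finsupp.smul_single, smul_eq_mul, ← Finsupp.single_add,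
        Nat.div_add_mod'] at this
    · rw [X_pow_eq_monomial]
      exact hasLead_monomial _
  rwa [Finsupp.univ_sum_single] at h

/-- Unitriangularity: `divMap` differs from the identity by a map that strictly lowers weight.
Injectivity and surjectivity each follow by induction on weight; counting dimensions would not do,
since variables of weight zero make the filtration pieces infinite-dimensional. -/
theorem divMap_sub_self_mem (hf : IsTriangular w S d f) {N : ℕ} {p : MvPolynomial σ K}
    (hp : p ∈ weightLT K w (N + 1)) : divMap S d f p - p ∈ weightLT K w N := by
  have h : divMap S d f p - p =
      ∑ e ∈ p.support, coeff e p • (divMonomial S d f e - monomial e 1) := by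
    conv_lhs => rw [p.as_sum]
    rw [map_sum, ← Finset.sum_sub_distrib]
    refine Finset.sum_congr rfl fun e _ => ?_
    rw [divMap_monomial, smul_sub, smul_monomial, smul_eq_mul, mul_one]
  rw [h]
  refine sum_mem fun e he => Submodule.smul_mem _ _ ?_
  exact weightLT_mono (Nat.le_of_lt_succ (hp he)) (hasLead_divMonomial hf e)

theorem divMap_injective (hf : IsTriangular w S d f) : Function.Injective (divMap S d f) := by
  rw [injective_iff_map_eq_zero]
  intro p hp
  obtain ⟨N, hN⟩ := exists_mem_weightLT w p
  induction N with
  | zero => exact support_eq_empty.1 (Finset.eq_empty_of_forall_notMem fun e he => by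
      simpa using hN he)
  | succ N ih =>
    refine ih ?_
    have := divMap_sub_self_mem hf hN
    rw [hp, zero_sub] at this
    exact neg_mem_iff.1 this

theorem exists_divMap_eq (hf : IsTriangular w S d f) {N : ℕ} {p : MvPolynomial σ K}
    (hp : p ∈ weightLT K w N) : ∃ q ∈ weightLT K w N, divMap S d f q = p := by
  induction N generalizing p with
  | zero =>
    have : p = 0 := support_eq_empty.1 (Finset.eq_empty_of_forall_notMem fun e he => by
      simpa using hp he)
    exact ⟨0, zero_mem _, by simp [this]⟩
  | succ N ih =>
    obtain ⟨q, hq, hqp⟩ := ih (divMap_sub_self_mem hf hp)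
    exact ⟨p - q, sub_mem hp (weightLT_mono (Nat.le_succ N) hq), by rw [map_sub, hqp]; ring⟩

theorem divMap_surjective (hf : IsTriangular w S d f) : Function.Surjective (divMap S d f) := by
  intro p
  obtain ⟨N, hN⟩ := exists_mem_weightLT w p
  obtain ⟨q, -, hq⟩ := exists_divMap_eq hf hN
  exact ⟨q, hq⟩

/-- Adding `d i` to the `i`-th exponent raises its quotient by `d i` by one and keeps the remainder.
-/
theorem mul_divMonomial (hd : ∀ i ∈ S, 0 < d i) {i : σ} (hi : i ∈ S) (e : σ →₀ ℕ) :
    f i * divMonomial S d f e = divMonomial S d f (e + Finsupp.single i (d i)) := by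
  unfold divMonomial
  rw [← Finset.mul_prod_erase _ _ (Finset.mem_univ i),
    ← Finset.mul_prod_erase _ (fun j => divPow S d f j _) (Finset.mem_univ i), ← mul_assoc]
  congr 1
  · simp only [divPow, if_pos hi, Finsupp.add_apply, Finsupp.single_eq_same,
      Nat.add_div_right _ (hd i hi), Nat.add_mod_right]
    ring
  · refine Finset.prod_congr rfl fun j hj => ?_
    rw [Finsupp.add_apply, Finsupp.single_eq_of_ne (Finset.ne_of_mem_erase hj), add_zero]

theorem mul_divMap (hd : ∀ i ∈ S, 0 < d i) {i : σ} (hi : i ∈ S) (p : MvPolynomial σ K) :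
    f i * divMap S d f p = divMap S d f (monomial (Finsupp.single i (d i)) 1 * p) := by
  induction p using MvPolynomial.induction_on' with
  | monomial e c =>
    rw [monomial_mul, one_mul, divMap_monomial, divMap_monomial, mul_smul_comm,
      mul_divMonomial hd hi, add_comm]
  | add p q hp hq => rw [map_add, mul_add, mul_add, map_add, hp, hq]

theorem monomial_mul_divMonomial {c : σ →₀ ℕ} (hc : ∀ i ∈ S, c i = 0) (e : σ →₀ ℕ) :
    monomial c (1 : K) * divMonomial S d f e = divMonomial S d f (c + e) := by
  have h : monomial c (1 : K) = ∏ i, X i ^ c i := by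
    rw [monomial_eq, C_1, one_mul, Finsupp.prod_fintype _ _ fun i => pow_zero _]
  rw [h, divMonomial, divMonomial, ← Finset.prod_mul_distrib]
  refine Finset.prod_congr rfl fun i _ => ?_
  rw [Finsupp.add_apply]
  by_cases hi : i ∈ S
  · rw [hc i hi, pow_zero, one_mul, zero_add]
  · simp only [divPow, if_neg hi, pow_add]

/-- `divMap` is linear over the polynomials in the variables outside `S`. -/
theorem mul_divMap_of_support {r : MvPolynomial σ K} (hr : ∀ c ∈ r.support, ∀ i ∈ S, c i = 0)
    (p : MvPolynomial σ K) : r * divMap S d f p = divMap S d f (r * p) := by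
  have key : ∀ c : σ →₀ ℕ, (∀ i ∈ S, c i = 0) → ∀ a : K,
      monomial c a * divMap S d f p = divMap S d f (monomial c a * p) := by
    intro c hc a
    induction p using MvPolynomial.induction_on' with
    | monomial e b =>
      have h : monomial c a = a • monomial c (1 : K) := by
        rw [smul_monomial, smul_eq_mul, mul_one]
      rw [monomial_mul, divMap_monomial, divMap_monomial, h, smul_mul_smul_comm,
        monomial_mul_divMonomial hc]
    | add p q hp hq => rw [map_add, mul_add, mul_add, map_add, hp, hq]
  conv_lhs => rw [r.as_sum, Finset.sum_mul]
  conv_rhs => rw [r.as_sum, Finset.sum_mul, map_sum]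
  exact Finset.sum_congr rfl fun c hc => key c (hr c hc) _

/-- Since `divMap` is bijective and turns multiplication by `X i ^ d i` into multiplication by `f
i`, it matches the two ideals. Allowing `T ⊆ S` gives access to the initial segments of the regular
sequence. -/
theorem divMap_mem_span_iff (hf : IsTriangular w S d f) {T : Finset σ} (hT : T ⊆ S)
    {p : MvPolynomial σ K} :
    divMap S d f p ∈ Ideal.span (f '' T) ↔ p ∈ monomialMultiples T d K := by
  have hd : ∀ i ∈ S, 0 < d i := fun i hi => (hf i hi).1
  constructor
  · intro h
    obtain ⟨g, hg⟩ := (Submodule.mem_span_image_finset_iff_exists_fun' _).1 h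
    choose G hG using fun i => divMap_surjective hf (g i)
    have : p = ∑ i ∈ T, monomial (Finsupp.single i (d i)) 1 * G i := by
      apply divMap_injective hf
      rw [← hg, map_sum]
      refine Finset.sum_congr rfl fun i hi => ?_
      rw [← mul_divMap hd (hT hi), hG, smul_eq_mul, mul_comm]
    rw [this]
    refine sum_mem fun i hi e he => ?_
    obtain ⟨x, hx, y, hy, rfl⟩ := Finset.mem_add.1 (support_mul _ _ he)
    rw [Finset.mem_singleton.1 (support_monomial_subset hx)]
    exact ⟨i, hi, by simp⟩
  · intro hp
    rw [p.as_sum, map_sum]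
    refine sum_mem fun e he => ?_
    obtain ⟨i, hi, hie⟩ := hp he
    rw [divMap_monomial]
    have : e = (e - Finsupp.single i (d i)) + Finsupp.single i (d i) :=
      (tsub_add_cancel_of_le (Finsupp.single_le_iff.2 hie)).symm
    rw [this, ← mul_divMonomial hd (hT hi), ← mul_smul_comm, mul_comm]
    exact Ideal.mul_mem_left _ _ (Ideal.subset_span ⟨i, hi, rfl⟩)

theorem exists_isReducedPoly_add (T : Finset σ) (d : σ → ℕ) (p : MvPolynomial σ K) :
    ∃ r m : MvPolynomial σ K, p = r + m ∧ IsReducedPoly T d r ∧ r.support ⊆ p.support ∧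
      m ∈ monomialMultiples T d K := by
  classical
  have hsub : (∑ e ∈ p.support with ∀ i ∈ T, e i < d i, monomial e (coeff e p)).support ⊆
      p.support.filter fun e => ∀ i ∈ T, e i < d i := by
    intro e he
    obtain ⟨e', he', h⟩ := Finset.mem_biUnion.1 (support_sum he)
    rwa [Finset.mem_singleton.1 (support_monomial_subset h)]
  refine ⟨∑ e ∈ p.support with ∀ i ∈ T, e i < d i, monomial e (coeff e p),
    ∑ e ∈ p.support with ¬ ∀ i ∈ T, e i < d i, monomial e (coeff e p), ?_, ?_, ?_, ?_⟩
  · rw [Finset.sum_filter_add_sum_filter_not]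
    exact p.as_sum
  · exact fun e he => (Finset.mem_filter.1 (hsub he)).2
  · exact fun e he => (Finset.mem_filter.1 (hsub he)).1
  · refine sum_mem fun e he => (monomial_mem_restrictSupport (R := K)).2 (Or.inl ?_)
    have := (Finset.mem_filter.1 he).2
    push Not at this
    exact this

theorem mul_mem_monomialMultiples {T : Finset σ} (r : MvPolynomial σ K) {p : MvPolynomial σ K}
    (hp : p ∈ monomialMultiples T d K) : r * p ∈ monomialMultiples T d K := by
  intro e he
  obtain ⟨x, hx, y, hy, rfl⟩ := Finset.mem_add.1 (support_mul _ _ he)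
  obtain ⟨i, hi, h⟩ := hp hy
  exact ⟨i, hi, h.trans (by simp)⟩

/-- Only the reduced part `q` of `p` matters. Multiplication by `r` leaves the exponents at `T`
unchanged, so no monomial of `r * q` can be a multiple, and `r * q = 0`. -/
theorem mem_monomialMultiples_of_mul_mem {T : Finset σ} {r p : MvPolynomial σ K} (hr0 : r ≠ 0)
    (hr : ∀ c ∈ r.support, ∀ i ∈ T, c i = 0) (h : r * p ∈ monomialMultiples T d K) :
    p ∈ monomialMultiples T d K := by
  obtain ⟨q, m, rfl, hq, -, hm⟩ := exists_isReducedPoly_add T d p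
  rw [mul_add] at h
  have h' := (Submodule.add_mem_iff_left _ (mul_mem_monomialMultiples r hm)).1 h
  suffices q = 0 by rwa [this, zero_add]
  by_contra hq0
  obtain ⟨e, he⟩ := support_nonempty.2 (mul_ne_zero hr0 hq0)
  obtain ⟨i, hi, hie⟩ := h' he
  obtain ⟨x, hx, y, hy, rfl⟩ := Finset.mem_add.1 (support_mul _ _ he)
  have := hr x hx i hi
  have := hq y hy i hi
  simp only [Finsupp.add_apply] at hie
  omega

theorem divMap_eq_self_of_isReducedPoly {p : MvPolynomial σ K} (hp : IsReducedPoly S d p) :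
    divMap S d f p = p := by
  conv_lhs => rw [p.as_sum, map_sum]
  conv_rhs => rw [p.as_sum]
  refine Finset.sum_congr rfl fun e he => ?_
  rw [divMap_monomial, monomial_eq, Finsupp.prod_fintype _ _ fun i => pow_zero _, smul_eq_C_mul]
  congr 1
  refine Finset.prod_congr rfl fun i _ => ?_
  unfold divPow
  split_ifs with hi
  · rw [Nat.div_eq_of_lt (hp e he i hi), Nat.mod_eq_of_lt (hp e he i hi), pow_zero, one_mul]
  · rfl

/-- Division with remainder by a triangular system. -/
theorem IsTriangular.exists_remainder (hf : IsTriangular w S d f) {N : ℕ} {p : MvPolynomial σ K}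
    (hp : p ∈ weightLT K w N) :
    ∃ r, IsReducedPoly S d r ∧ r ∈ weightLT K w N ∧ p - r ∈ Ideal.span (f '' S) := by
  obtain ⟨q, hq, rfl⟩ := exists_divMap_eq hf hp
  obtain ⟨r, m, rfl, hr, hsub, hm⟩ := exists_isReducedPoly_add S d q
  refine ⟨r, hr, fun e he => hq (hsub he), ?_⟩
  rw [map_add, divMap_eq_self_of_isReducedPoly hr, add_sub_cancel_left]
  exact (divMap_mem_span_iff hf subset_rfl).2 hm

/-- A nonzero polynomial in the variables outside `S` is regular modulo a triangular system. -/
theorem IsTriangular.mem_of_mul_mem (hf : IsTriangular w S d f) {r p : MvPolynomial σ K}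
    (hr0 : r ≠ 0) (hr : ∀ c ∈ r.support, ∀ i ∈ S, c i = 0)
    (h : r * p ∈ Ideal.span (f '' S)) : p ∈ Ideal.span (f '' S) := by
  obtain ⟨q, rfl⟩ := divMap_surjective hf p
  rw [mul_divMap_of_support hr, divMap_mem_span_iff hf subset_rfl] at h
  rw [divMap_mem_span_iff hf subset_rfl]
  exact mem_monomialMultiples_of_mul_mem hr0 hr h

/-- Each member of a triangular system is regular modulo any set of the others. -/
theorem IsTriangular.mem_of_apply_mul_mem (hf : IsTriangular w S d f) {T : Finset σ} (hT : T ⊆ S)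
    {i : σ} (hi : i ∈ S) (hiT : i ∉ T) {p : MvPolynomial σ K}
    (h : f i * p ∈ Ideal.span (f '' T)) : p ∈ Ideal.span (f '' T) := by
  obtain ⟨q, rfl⟩ := divMap_surjective hf p
  rw [mul_divMap (fun i hi => (hf i hi).1) hi, divMap_mem_span_iff hf hT] at h
  rw [divMap_mem_span_iff hf hT]
  refine mem_monomialMultiples_of_mul_mem (by simp) (fun c hc j hj => ?_) h
  rw [Finset.mem_singleton.1 (support_monomial_subset hc)]
  exact Finsupp.single_eq_of_ne fun h => hiT (h ▸ hj)

theorem IsTriangular.span_ne_top (hf : IsTriangular w S d f) : Ideal.span (f '' S) ≠ ⊤ := by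
  have h1 : IsReducedPoly S d (1 : MvPolynomial σ K) := by
    intro e he i hi
    rw [Finset.mem_singleton.1 (support_monomial_subset (s := 0) (a := (1 : K)) he)]
    exact (hf i hi).1
  rw [Ne, Ideal.eq_top_iff_one, ← divMap_eq_self_of_isReducedPoly (f := f) h1,
    divMap_mem_span_iff hf subset_rfl]
  intro h
  obtain ⟨i, hi, hle⟩ := h (a := 0) (by simp)
  exact absurd hle (not_le.2 (hf i hi).1)

end Triangular

/-! ### Irreducible varieties and prime ideals -/

section Varieties

variable {K : Type*} [Field K] {Ω : Type*} [Field Ω] [Algebra K Ω] {σ : Type*} [Fintype σ]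

theorem IsVariety.zeroLocus_vanishingIdeal {W : Set (σ → Ω)} (hW : IsVariety K W) :
    zeroLocus Ω (vanishingIdeal K W) = W := by
  obtain ⟨I, rfl⟩ := hW
  exact Set.Subset.antisymm (zeroLocus_anti_mono (le_vanishingIdeal_zeroLocus I))
    (zeroLocus_vanishingIdeal_le _)

theorem zeroLocus_sup (I J : Ideal (MvPolynomial σ K)) :
    zeroLocus Ω (I ⊔ J) = zeroLocus Ω I ∩ zeroLocus Ω J := by
  refine Set.ext fun x => ⟨fun h => ⟨fun p hp => ?_, fun p hp => ?_⟩, fun h p hp => ?_⟩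
  · exact h p (Ideal.mem_sup_left hp)
  · exact h p (Ideal.mem_sup_right hp)
  · obtain ⟨a, ha, b, hb, rfl⟩ := Submodule.mem_sup.1 hp
    rw [map_add, h.1 a ha, h.2 b hb, add_zero]

theorem isVariety_inter_zeroLocus {W : Set (σ → Ω)} (hW : IsVariety K W)
    (I : Ideal (MvPolynomial σ K)) : IsVariety K (W ∩ zeroLocus Ω I) := by
  obtain ⟨J, rfl⟩ := hW
  exact ⟨J ⊔ I, (zeroLocus_sup J I).symm⟩

theorem IsIrredVariety.subset_or_subset {W A B : Set (σ → Ω)} (hW : IsIrredVariety K W)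
    (hA : IsVariety K A) (hB : IsVariety K B) (h : W ⊆ A ∪ B) : W ⊆ A ∨ W ⊆ B := by
  obtain ⟨I, rfl⟩ := hA
  obtain ⟨J, rfl⟩ := hB
  refine (hW.2.2 _ _ (isVariety_inter_zeroLocus hW.1 I) (isVariety_inter_zeroLocus hW.1 J) ?_).imp
    Set.inter_eq_left.1 Set.inter_eq_left.1
  rw [← Set.inter_union_distrib_left, Set.inter_eq_left.2 h]

theorem IsIrredVariety.isPrime_vanishingIdeal {W : Set (σ → Ω)} (hW : IsIrredVariety K W) :
    (vanishingIdeal K W).IsPrime := by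
  refine Ideal.isPrime_iff.2 ⟨fun h => ?_, fun {p q} hpq => ?_⟩
  · obtain ⟨x, hx⟩ := hW.2.1
    have : (1 : MvPolynomial σ K) ∈ vanishingIdeal K W := h ▸ Submodule.mem_top
    simpa using this x hx
  · have key : ∀ r : MvPolynomial σ K, W ⊆ zeroLocus Ω (Ideal.span {r}) →
        r ∈ vanishingIdeal K W := fun r hr x hx => hr hx r (Ideal.mem_span_singleton_self r)
    refine (hW.subset_or_subset ⟨Ideal.span {p}, rfl⟩ ⟨Ideal.span {q}, rfl⟩ fun x hx => ?_).imp
      (key p) (key q)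
    have := hpq x hx
    rw [map_mul, mul_eq_zero] at this
    simpa [zeroLocus_span] using this

theorem IsIrredVariety.exists_subset_of_subset_biUnion {ι : Type*} {W : Set (σ → Ω)}
    (hW : IsIrredVariety K W) (s : Finset ι) (I : ι → Ideal (MvPolynomial σ K))
    (h : W ⊆ ⋃ i ∈ s, zeroLocus Ω (I i)) : ∃ i ∈ s, W ⊆ zeroLocus Ω (I i) := by
  by_contra! hcon
  have hp := hW.isPrime_vanishingIdeal
  have : ∀ i ∈ s, ∃ p ∈ I i, p ∉ vanishingIdeal K W := by
    intro i hi
    by_contra! hc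
    exact hcon i hi (le_zeroLocus_iff_le_vanishingIdeal.2 hc)
  choose! p hp1 hp2 using this
  have hmem : ∏ i ∈ s, p i ∈ vanishingIdeal K W := by
    intro x hx
    obtain ⟨i, hi, hxi⟩ := Set.mem_iUnion₂.1 (h hx)
    rw [map_prod]
    exact Finset.prod_eq_zero hi (hxi _ (hp1 i hi))
  obtain ⟨i, hi, hi'⟩ := (hp.prod_mem_iff).1 hmem
  exact hp2 i hi hi'

theorem dim_mono {V W : Set (σ → Ω)} (h : V ⊆ W) : dim K V ≤ dim K W :=
  Order.krullDim_le_of_strictMono (fun C => ⟨C.1, C.2.1, C.2.2.trans h⟩) fun _ _ hlt => hlt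

/-- The dimension of a set covered by finitely many varieties, bounded by Krull dimensions. -/
theorem dim_le_of_subset_biUnion {ι : Type*} {V : Set (σ → Ω)} (s : Finset ι)
    (I : ι → Ideal (MvPolynomial σ K)) (h : V ⊆ ⋃ i ∈ s, zeroLocus Ω (I i)) {N : WithBot ℕ∞}
    (hN : ∀ i ∈ s, ringKrullDim (MvPolynomial σ K ⧸ I i) ≤ N) : dim K V ≤ N := by
  rw [dim, Order.krullDim_eq_iSup_height]
  refine iSup_le fun W => ?_
  obtain ⟨i, hi, hWi⟩ := W.2.1.exists_subset_of_subset_biUnion s I (W.2.2.trans h)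
  refine le_trans ?_ (hN i hi)
  -- The height of `W` is the dimension of the poset of irreducible varieties inside `W`. All of
  -- them lie in the zero locus of the single ideal `I i`, so vanishing ideals embed this poset,
  -- reversed, into the primes over `I i`.
  rw [Order.height_eq_krullDim_Iic, ← Order.krullDim_orderDual, ringKrullDim,
    Order.krullDim_eq_of_orderIso (Ideal.primeSpectrumQuotientOrderIsoZeroLocus (I i))]
  refine Order.krullDim_le_of_strictMono (fun C => ⟨⟨vanishingIdeal K (OrderDual.ofDual C).1.1,
    (OrderDual.ofDual C).1.2.1.isPrime_vanishingIdeal⟩, ?_⟩) ?_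
  · exact le_zeroLocus_iff_le_vanishingIdeal.1 (subset_trans (OrderDual.ofDual C).2 hWi)
  · intro C D hlt
    have hlt' : (OrderDual.ofDual D).1.1 < (OrderDual.ofDual C).1.1 := hlt
    refine lt_of_le_of_ne (vanishingIdeal_anti_mono hlt'.le) fun heq => hlt'.ne ?_
    have heq' : vanishingIdeal K (OrderDual.ofDual C).1.1 =
      vanishingIdeal K (OrderDual.ofDual D).1.1 := congr_arg (fun q => q.1.asIdeal) heq
    rw [← (OrderDual.ofDual D).1.2.1.1.zeroLocus_vanishingIdeal, ← heq',
      (OrderDual.ofDual C).1.2.1.1.zeroLocus_vanishingIdeal]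

variable [IsAlgClosed Ω]

/-- By the Nullstellensatz, with coefficients in `K` and points in `Ω`, the vanishing ideal of the
zero locus of `P` is `P` itself; primality then forbids a proper decomposition. -/
theorem isIrredVariety_zeroLocus (P : Ideal (MvPolynomial σ K)) [hP : P.IsPrime] :
    IsIrredVariety K (zeroLocus Ω P) := by
  have hPI : vanishingIdeal K (zeroLocus Ω P) = P := IsPrime.vanishingIdeal_zeroLocus P
  refine ⟨⟨P, rfl⟩, ?_, fun A B hA hB h => ?_⟩
  · rw [Set.nonempty_iff_ne_empty]
    intro h
    rw [h, vanishingIdeal_empty] at hPI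
    exact hP.ne_top hPI.symm
  · have hle : vanishingIdeal K A ⊓ vanishingIdeal K B ≤ P := by
      rw [← hPI, h]
      rintro p ⟨hpA, hpB⟩ x (hx | hx)
      exacts [hpA x hx, hpB x hx]
    refine (hP.inf_le.1 hle).imp (fun hVP => ?_) (fun hVP => ?_)
    · refine (Set.Subset.antisymm (h ▸ Set.subset_union_left) ?_)
      rw [← hA.zeroLocus_vanishingIdeal]
      exact zeroLocus_anti_mono hVP
    · refine (Set.Subset.antisymm (h ▸ Set.subset_union_right) ?_)
      rw [← hB.zeroLocus_vanishingIdeal]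
      exact zeroLocus_anti_mono hVP

/-- The irreducible components of the zero locus of `I` correspond to minimal primes of `I`. -/
theorem vanishingIdeal_mem_minimalPrimes {I : Ideal (MvPolynomial σ K)} {C : Set (σ → Ω)}
    (hC : C ∈ components K (zeroLocus Ω I)) : vanishingIdeal K C ∈ I.minimalPrimes := by
  replace hC : Maximal (fun W => IsIrredVariety K W ∧ W ⊆ zeroLocus Ω I) C := hC
  have hirr := hC.prop.1
  refine ⟨⟨hirr.isPrime_vanishingIdeal,
    le_zeroLocus_iff_le_vanishingIdeal.1 hC.prop.2⟩, fun Q hQ hle => ?_⟩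
  have := hQ.1
  have h := hC.le_of_ge (y := zeroLocus Ω Q)
    ⟨isIrredVariety_zeroLocus Q, zeroLocus_anti_mono hQ.2⟩ (by
      rw [← hirr.1.zeroLocus_vanishingIdeal]
      exact zeroLocus_anti_mono hle)
  rw [← IsPrime.vanishingIdeal_zeroLocus (K := Ω) Q]
  exact vanishingIdeal_anti_mono h

theorem zeroLocus_mem_components {I P : Ideal (MvPolynomial σ K)} (hP : P ∈ I.minimalPrimes) :
    zeroLocus Ω P ∈ components K (zeroLocus Ω I) := by
  have := hP.1.1
  refine ⟨⟨isIrredVariety_zeroLocus P, zeroLocus_anti_mono hP.1.2⟩, fun W hW hle => ?_⟩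
  have hle' : vanishingIdeal K W ≤ P := by
    rw [← IsPrime.vanishingIdeal_zeroLocus (K := Ω) P]
    exact vanishingIdeal_anti_mono hle
  have := hP.2 ⟨hW.1.isPrime_vanishingIdeal, le_zeroLocus_iff_le_vanishingIdeal.1 hW.2⟩ hle'
  exact le_zeroLocus_iff_le_vanishingIdeal.2 this

theorem exists_mem_components {I : Ideal (MvPolynomial σ K)} {x : σ → Ω}
    (hx : x ∈ zeroLocus Ω I) : ∃ C ∈ components K (zeroLocus Ω I), x ∈ C := by
  have hirr : (vanishingIdeal K {x}).IsPrime := by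
    refine Ideal.isPrime_iff.2 ⟨fun h => ?_, fun {p q} hpq => ?_⟩
    · have : (1 : MvPolynomial σ K) ∈ vanishingIdeal K {x} := h ▸ Submodule.mem_top
      simpa using this x rfl
    · have := hpq x rfl
      rw [map_mul, mul_eq_zero] at this
      exact this.imp (fun h y hy => hy ▸ h) (fun h y hy => hy ▸ h)
  obtain ⟨P, hP, hle⟩ := Ideal.exists_minimalPrimes_le (J := vanishingIdeal K {x}) (I := I)
    (fun p hp y hy => hy ▸ hx p hp)
  exact ⟨_, zeroLocus_mem_components hP, fun p hp => hle hp x rfl⟩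

theorem dim_zeroLocus (I : Ideal (MvPolynomial σ K)) :
    dim K (zeroLocus Ω I) = ringKrullDim (MvPolynomial σ K ⧸ I) := by
  refine le_antisymm (dim_le_of_subset_biUnion {()} (fun _ => I)
    (fun x hx => Set.mem_iUnion₂.2 ⟨(), Finset.mem_singleton_self _, hx⟩) (by simp)) ?_
  rw [ringKrullDim, Order.krullDim_eq_of_orderIso (Ideal.primeSpectrumQuotientOrderIsoZeroLocus I),
    dim, ← Order.krullDim_orderDual]
  refine Order.krullDim_le_of_strictMono
    (fun P => ⟨zeroLocus Ω (OrderDual.ofDual P).1.asIdeal, ?_, ?_⟩) ?_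
  · have := (OrderDual.ofDual P).1.2
    exact isIrredVariety_zeroLocus _
  · exact zeroLocus_anti_mono (OrderDual.ofDual P).2
  · intro P Q hlt
    have hlt' : (OrderDual.ofDual Q).1.asIdeal < (OrderDual.ofDual P).1.asIdeal := hlt
    have := (OrderDual.ofDual P).1.2
    have := (OrderDual.ofDual Q).1.2
    refine lt_of_le_of_ne (zeroLocus_anti_mono hlt'.le) fun heq => hlt'.ne ?_
    have heq' : zeroLocus Ω (OrderDual.ofDual P).1.asIdeal =
      zeroLocus Ω (OrderDual.ofDual Q).1.asIdeal := congr_arg (fun q => q.1) heq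
    rw [← IsPrime.vanishingIdeal_zeroLocus (K := Ω) (OrderDual.ofDual Q).1.asIdeal, ← heq',
      IsPrime.vanishingIdeal_zeroLocus]

end Varieties

/-! ### Krull dimension and heights in finite extensions of polynomial rings -/

section Dimension

theorem ringKrullDim_le_of_isIntegral {R S : Type*} [CommRing R] [CommRing S] (f : R →+* S)
    (hf : f.IsIntegral) : ringKrullDim S ≤ ringKrullDim R := by
  let := f.toAlgebra
  have : Algebra.IsIntegral R S := ⟨hf⟩
  refine Order.krullDim_le_of_strictMono (PrimeSpectrum.comap (algebraMap R S)) fun P Q h => ?_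
  exact Ideal.IsIntegral.comap_lt_comap (I := P.asIdeal) (J := Q.asIdeal) h

/-- Induction on the number of variables: polynomial rings over a field are Jacobson, so a maximal
ideal contracts to a maximal ideal when one variable is removed, and the height drops by one. -/
theorem height_eq_natCard_of_isMaximal {K : Type*} [Field K] {ι : Type*} [Finite ι]
    (M : Ideal (MvPolynomial ι K)) [hM : M.IsMaximal] : M.height = Nat.card ι := by
  induction ι using Finite.induction_empty_option with
  | of_equiv e H =>
    have := Ideal.comap_isMaximal_of_equiv (renameEquiv K e) (p := M)
    have h := H (M.comap (renameEquiv K e))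
    rw [← Nat.card_congr e, ← h]
    exact (RingEquiv.height_comap (renameEquiv K e).toRingEquiv M).symm
  | h_empty =>
    have : M = ⊥ := by
      have hF : IsField (MvPolynomial PEmpty K) :=
        (isEmptyRingEquiv K PEmpty).toMulEquiv.isField (Field.toIsField K)
      let := hF.toField
      exact (Ideal.eq_bot_or_top M).resolve_right hM.ne_top
    simp [this]
  | @h_option ι _ IH =>
    let e := (optionEquivLeft K ι).symm
    have hm := Ideal.comap_isMaximal_of_equiv e (p := M)
    have h1 := RingEquiv.height_comap e.toRingEquiv M
    set N : Ideal (Polynomial (MvPolynomial ι K)) := M.comap e with hN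
    have hp : (N.comap (Polynomial.C)).IsMaximal := Polynomial.isMaximal_comap_C_of_isJacobsonRing N
    have : N.LiesOver (N.comap Polynomial.C) := ⟨rfl⟩
    have h2 := Polynomial.height_eq_height_add_one (N.comap Polynomial.C) N
    rw [IH (N.comap Polynomial.C)] at h2
    rw [← h1, Finite.card_option]
    exact_mod_cast h2

theorem isIntegral_of_closure_eq_top {R E ι : Type*} [CommRing R] [CommRing E] [Finite ι]
    (φ : R →+* E) (b : ι → E)
    (h : AddSubmonoid.closure {q | ∃ r i, φ r * b i = q} = ⊤) : φ.IsIntegral := by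
  apply RingHom.Finite.to_isIntegral
  let := φ.toAlgebra
  have : Fintype ι := Fintype.ofFinite ι
  classical
  refine ⟨⟨Finset.univ.image b, eq_top_iff.2 fun q _ => ?_⟩⟩
  have hq : q ∈ AddSubmonoid.closure {q | ∃ r i, φ r * b i = q} := h ▸ AddSubmonoid.mem_top q
  induction hq using AddSubmonoid.closure_induction with
  | mem x hx =>
    obtain ⟨r, i, rfl⟩ := hx
    exact Submodule.smul_mem _ r (Submodule.subset_span (by simp))
  | zero => exact zero_mem _
  | add x y _ _ hx hy => exact add_mem (hx trivial) (hy trivial)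

variable {K : Type*} [Field K] {σ : Type*} [Fintype σ]

/-- The map from the polynomials in the variables outside `S` to a quotient of the polynomial
ring in all variables. -/
def paramMap (S : Finset σ) (J : Ideal (MvPolynomial σ K)) :
    MvPolynomial {i // i ∉ S} K →+* MvPolynomial σ K ⧸ J :=
  (Ideal.Quotient.mk J).comp (rename Subtype.val : MvPolynomial {i // i ∉ S} K →ₐ[K] _).toRingHom

/-- A reduced monomial is a monomial in the free variables times some `∏ X i ^ c i` over `S` with `c
i < d i`. These finitely many products generate the quotient as a module. -/
theorem paramMap_isIntegral {S : Finset σ} {d : σ → ℕ} {J : Ideal (MvPolynomial σ K)}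
    (hJ : ∀ p, ∃ r, IsReducedPoly S d r ∧ p - r ∈ J) : (paramMap S J).IsIntegral := by
  classical
  refine isIntegral_of_closure_eq_top _ (fun c : ∀ i : S, Fin (d i) =>
    Ideal.Quotient.mk J (∏ i : S, X (i : σ) ^ (c i : ℕ))) ?_
  rw [eq_top_iff]
  rintro q -
  obtain ⟨p, rfl⟩ := Ideal.Quotient.mk_surjective q
  obtain ⟨r, hr, hpr⟩ := hJ p
  rw [Ideal.Quotient.eq.2 hpr, r.as_sum, map_sum]
  refine sum_mem fun e he => ?_
  have h : monomial e (coeff e r) =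
      rename Subtype.val (C (coeff e r) * ∏ i : {i // i ∉ S}, X i ^ e i) *
        ∏ i : S, X (i : σ) ^ e i := by
    rw [monomial_eq, Finsupp.prod_fintype _ _ fun i => pow_zero _, map_mul, map_prod,
      rename_C, mul_assoc]
    congr 1
    simp only [map_pow, rename_X]
    refine Eq.trans ?_ (mul_comm _ _)
    convert (Fintype.prod_subtype_mul_prod_subtype (fun i => i ∈ S)
      (fun i => (X i : MvPolynomial σ K) ^ e i)).symm
  rw [h, map_mul]
  exact AddSubmonoid.subset_closure ⟨C (coeff e r) * ∏ i : {i // i ∉ S}, X i ^ e i,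
    fun i => ⟨e i, hr e he i i.2⟩, rfl⟩

/-- Going-down holds for an integral extension of the normal polynomial ring, so `M` is at least as
high as its contraction, a maximal ideal of a polynomial ring. -/
theorem natCard_le_height {S : Finset σ} {P : Ideal (MvPolynomial σ K)} [P.IsPrime]
    (hInt : (paramMap S P).IsIntegral) (hinj : Function.Injective (paramMap S P))
    (M : Ideal (MvPolynomial σ K ⧸ P)) [M.IsMaximal] :
    (Nat.card {i // i ∉ S} : ℕ∞) ≤ M.height := by
  let := (paramMap S P).toAlgebra
  have : Algebra.IsIntegral (MvPolynomial {i // i ∉ S} K) (MvPolynomial σ K ⧸ P) := ⟨hInt⟩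
  have : FaithfulSMul (MvPolynomial {i // i ∉ S} K) (MvPolynomial σ K ⧸ P) :=
    (faithfulSMul_iff_algebraMap_injective _ _).2 hinj
  have h := Ideal.height_eq_height_add_of_liesOver_of_hasGoingDown
    (M.under (MvPolynomial {i // i ∉ S} K)) M
  rw [h, height_eq_natCard_of_isMaximal (M.under (MvPolynomial {i // i ∉ S} K))]
  exact le_self_add

theorem ringKrullDim_quotient_le {S : Finset σ} {J : Ideal (MvPolynomial σ K)}
    (hInt : (paramMap S J).IsIntegral) :
    ringKrullDim (MvPolynomial σ K ⧸ J) ≤ Nat.card {i // i ∉ S} := by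
  refine (ringKrullDim_le_of_isIntegral _ hInt).trans ?_
  rw [MvPolynomial.ringKrullDim_of_isNoetherianRing, ringKrullDim_eq_zero_of_field, zero_add]

theorem ringKrullDim_quotient_eq {S : Finset σ} {P : Ideal (MvPolynomial σ K)} [P.IsPrime]
    (hInt : (paramMap S P).IsIntegral) (hinj : Function.Injective (paramMap S P)) :
    ringKrullDim (MvPolynomial σ K ⧸ P) = Nat.card {i // i ∉ S} := by
  refine le_antisymm (ringKrullDim_quotient_le hInt) ?_
  obtain ⟨M, hM⟩ := Ideal.exists_maximal (MvPolynomial σ K ⧸ P)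
  refine le_trans ?_ (Ideal.height_le_ringKrullDim_of_isPrime (I := M))
  exact_mod_cast natCard_le_height hInt hinj M

/-- Krull's height theorem: fewer equations than the dimension do not isolate a point. -/
theorem exists_isPrime_lt_of_card_lt {S : Finset σ} {P M : Ideal (MvPolynomial σ K)} [P.IsPrime]
    [hM : M.IsMaximal] (hInt : (paramMap S P).IsIntegral)
    (hinj : Function.Injective (paramMap S P)) (hPM : P ≤ M) (s : Finset (MvPolynomial σ K))
    (hs : (s : Set (MvPolynomial σ K)) ⊆ M) (hcard : s.card < Nat.card {i // i ∉ S}) :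
    ∃ Q : Ideal (MvPolynomial σ K), Q.IsPrime ∧ P ≤ Q ∧ (s : Set (MvPolynomial σ K)) ⊆ Q ∧
      Q < M := by
  classical
  let π := Ideal.Quotient.mk P
  have hker : RingHom.ker π ≤ M := by rwa [Ideal.mk_ker]
  have hπ : Function.Surjective π := Ideal.Quotient.mk_surjective
  have hcm : (M.map π).comap π = M := by
    rw [Ideal.comap_map_of_surjective' _ hπ, sup_eq_left]; exact hker
  have hMm : (M.map π).IsMaximal :=
    Ideal.IsMaximal.map_of_surjective_of_ker_le hπ hker
  have hle : Ideal.span (s.image π : Set _) ≤ M.map π := by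
    rw [Ideal.span_le]
    intro y hy
    obtain ⟨p, hp, rfl⟩ := Finset.mem_image.1 hy
    exact Ideal.mem_map_of_mem _ (hs hp)
  -- A minimal prime over `s` would have height at most `s.card`, which is less than the number of
  -- free variables and hence than the height of `M` modulo `P`.
  have hnot : M.map π ∉ (Ideal.span (s.image π : Set _)).minimalPrimes := fun hmin => by
    have h1 := Ideal.height_le_card_of_mem_minimalPrimes_span_finset hmin
    have h2 := (natCard_le_height hInt hinj (M.map π)).trans h1
    have h3 := Finset.card_image_le (s := s) (f := π)
    have h4 : Nat.card {i // i ∉ S} ≤ (s.image π).card := by exact_mod_cast h2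
    omega
  obtain ⟨Q, hQ, hQM⟩ := Ideal.exists_minimalPrimes_le hle
  have hne : Q ≠ M.map π := fun h => hnot (h ▸ hQ)
  have hQp := hQ.1.1
  refine ⟨Q.comap π, Ideal.comap_isPrime _ _, ?_, ?_, ?_⟩
  · exact Ideal.mk_ker.symm.trans_le (Ideal.ker_le_comap π)
  · intro p hp
    exact hQ.1.2 (Ideal.subset_span (Finset.mem_image_of_mem _ hp))
  · refine lt_of_le_of_ne (hcm ▸ Ideal.comap_mono hQM) fun h => hne ?_
    rw [← h, Ideal.map_comap_of_surjective _ hπ]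

end Dimension

/-! ### Extension of the base field -/

section BaseChange

attribute [local instance] MvPolynomial.algebraMvPolynomial

variable {K : Type*} [Field K] {Ω : Type*} [Field Ω] [Algebra K Ω] {σ : Type*} 

/-- Going-down for the flat base change to `Ω`. The extension of `P` to `Ω` need not be prime, so
primes lying over `P` take its place. -/
theorem exists_isPrime_comap_map_eq {P : Ideal (MvPolynomial σ K)} [P.IsPrime]
    {M : Ideal (MvPolynomial σ Ω)} [M.IsPrime] (h : P.map (map (algebraMap K Ω)) ≤ M) :
    ∃ Q : Ideal (MvPolynomial σ Ω), Q.IsPrime ∧ Q ≤ M ∧ Q.comap (map (algebraMap K Ω)) = P := by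
  have : Module.Flat (MvPolynomial σ K) (MvPolynomial σ Ω) :=
    Module.Flat.isBaseChange K (MvPolynomial σ K) Ω (MvPolynomial σ Ω)
      (Algebra.IsPushout.out (R := K) (S := MvPolynomial σ K) (R' := Ω) (S' := MvPolynomial σ Ω))
  obtain ⟨Q, hQM, hQ, hQP⟩ := Ideal.exists_ideal_le_liesOver_of_le (p := P)
    (q := M.under (MvPolynomial σ K)) M (Ideal.map_le_iff_le_comap.1 h)
  exact ⟨Q, hQ, hQM, hQP.over.symm⟩

theorem eq_bot_of_comap_map_eq_bot [Algebra.IsAlgebraic K Ω] {Q : Ideal (MvPolynomial σ Ω)}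
    (h : Q.comap (map (algebraMap K Ω)) = ⊥) : Q = ⊥ := by
  have : Algebra.IsIntegral (MvPolynomial σ K) (MvPolynomial σ Ω) := inferInstance
  exact Ideal.eq_bot_of_comap_eq_bot (R := MvPolynomial σ K) h

end BaseChange

/-! ### Linear sections of varieties -/

section Slices

variable {K : Type*} [Field K] {Ω : Type*} [Field Ω] [Algebra K Ω] {σ : Type*} [Fintype σ]

theorem exists_eval_eq_one_and_eq_zero (s : Finset (σ → Ω)) (x : σ → Ω) :
    ∃ h : MvPolynomial σ Ω, aeval x h = 1 ∧ ∀ y ∈ s, y ≠ x → aeval y h = 0 := by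
  classical
  have key : ∀ y : σ → Ω, ∃ h : MvPolynomial σ Ω,
      y ≠ x → aeval x h = 1 ∧ aeval y h = 0 := by
    intro y
    by_cases hy : y = x
    · exact ⟨0, fun h => absurd hy h⟩
    · obtain ⟨i, hi⟩ := Function.ne_iff.1 hy
      refine ⟨C (x i - y i)⁻¹ * (X i - C (y i)), fun _ => ⟨?_, ?_⟩⟩
      · have : x i - y i ≠ 0 := sub_ne_zero.2 (Ne.symm hi)
        simp [this]
      · simp
  choose h hh using key
  refine ⟨∏ y ∈ s.erase x, h y, ?_, fun y hy hyx => ?_⟩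
  · rw [map_prod]
    exact Finset.prod_eq_one fun y hy => (hh y (Finset.ne_of_mem_erase hy)).1
  · rw [map_prod]
    exact Finset.prod_eq_zero (Finset.mem_erase.2 ⟨hyx, hy⟩) (hh y hyx).2

theorem mem_zeroLocus_of_map_le {P : Ideal (MvPolynomial σ K)} {Q : Ideal (MvPolynomial σ Ω)}
    (h : P.map (map (algebraMap K Ω)) ≤ Q) {x : σ → Ω} (hx : x ∈ zeroLocus Ω Q) :
    x ∈ zeroLocus Ω P := by
  intro p hp
  have := hx _ (h (Ideal.mem_map_of_mem _ hp))
  rwa [aeval_map_algebraMap] at this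

theorem map_le_vanishingIdeal_singleton {P : Ideal (MvPolynomial σ K)} {x : σ → Ω}
    (hx : x ∈ zeroLocus Ω P) : P.map (map (algebraMap K Ω)) ≤ vanishingIdeal Ω {x} := by
  refine Ideal.map_le_iff_le_comap.2 fun p hp y hy => ?_
  rw [Set.mem_singleton_iff.1 hy, aeval_map_algebraMap]
  exact hx p hp

/-- The points `pts` of the zero locus of `P` lie on the linear space `l = 0`, which meets
the zero locus in finitely many points. -/
structure IsSlice {τ : Type*} (P : Ideal (MvPolynomial σ K)) (pts : Finset (σ → Ω))
    (l : τ → MvPolynomial σ Ω) : Prop where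
  linear : ∀ i, l i ∈ weightLT Ω (fun _ => 1) 2
  mem : ∀ x ∈ pts, x ∈ zeroLocus Ω P
  vanish : ∀ x ∈ pts, ∀ i, aeval x (l i) = 0
  finite : pts.Nonempty → {x ∈ zeroLocus Ω P | ∀ i, aeval x (l i) = 0}.Finite

variable [IsAlgClosed Ω]

/-- `Q` is the intersection of the maximal ideals of its finitely many zeros; being prime, it
contains one of them. -/
theorem eq_vanishingIdeal_singleton_of_finite {Q : Ideal (MvPolynomial σ Ω)} [hQ : Q.IsPrime]
    (hfin : (zeroLocus Ω Q).Finite) {x : σ → Ω} (hx : Q ≤ vanishingIdeal Ω {x}) :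
    Q = vanishingIdeal Ω {x} := by
  have hle : hfin.toFinset.inf (fun y => vanishingIdeal Ω ({y} : Set (σ → Ω))) ≤ Q := by
    intro p hp
    suffices p ∈ vanishingIdeal Ω (zeroLocus Ω Q) by
      rwa [IsPrime.vanishingIdeal_zeroLocus] at this
    intro y hy
    exact (Finset.inf_le (f := fun y => vanishingIdeal Ω ({y} : Set (σ → Ω)))
      (hfin.mem_toFinset.2 hy)) hp y rfl
  obtain ⟨y, -, hy⟩ := hQ.inf_le'.1 hle
  have h := (inferInstance : (vanishingIdeal Ω ({y} : Set (σ → Ω))).IsMaximal).eq_of_le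
    (Ideal.IsPrime.ne_top inferInstance) (hy.trans hx)
  exact le_antisymm hx (h ▸ hy)

variable [Algebra.IsAlgebraic K Ω]

/-- The contraction of `Q` to `Ω[free variables]` meets `K[free variables]` in zero, and an ideal of
an integral extension domain with zero contraction is zero. -/
theorem paramMap_injective_of_comap {S : Finset σ} {P : Ideal (MvPolynomial σ K)}
    (hinj : P.comap (rename (Subtype.val : {i // i ∉ S} → σ) : _ →ₐ[K] _) = ⊥)
    {Q : Ideal (MvPolynomial σ Ω)} (hQ : Q.comap (map (algebraMap K Ω)) = P) :
    Function.Injective (paramMap S Q) := by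
  rw [injective_iff_map_eq_zero]
  intro p hp
  have hp' : p ∈ Q.comap (rename (Subtype.val : {i // i ∉ S} → σ) : _ →ₐ[Ω] _) :=
    Ideal.mem_comap.2 (Ideal.Quotient.eq_zero_iff_mem.1 hp)
  rw [eq_bot_of_comap_map_eq_bot (K := K)
    (Q := Q.comap (rename (Subtype.val : {i // i ∉ S} → σ) : _ →ₐ[Ω] _))] at hp'
  · exact hp'
  · rw [eq_bot_iff, ← hinj]
    intro r hr
    rw [← hQ]
    simp only [Ideal.mem_comap] at hr ⊢
    rwa [map_rename]

/-- The powers of the linear forms of a slice, times polynomials separating the points,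
are independent on the variety. -/
theorem IsSlice.eq_zero {S : Finset σ} [Nonempty {i // i ∉ S}] {P : Ideal (MvPolynomial σ K)}
    [P.IsPrime] {pts : Finset (σ → Ω)} {l : {i // i ∉ S} → MvPolynomial σ Ω}
    (hl : IsSlice P pts l)
    (hInt : ∀ Q : Ideal (MvPolynomial σ Ω), P.map (map (algebraMap K Ω)) ≤ Q →
      (paramMap S Q).IsIntegral)
    (hinj : P.comap (rename (Subtype.val : {i // i ∉ S} → σ) : _ →ₐ[K] _) = ⊥)
    {h : (σ → Ω) → MvPolynomial σ Ω} (h1 : ∀ x ∈ pts, aeval x (h x) = 1)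
    (h0 : ∀ x ∈ pts, ∀ y ∈ pts, y ≠ x → aeval y (h x) = 0)
    {a : (σ → Ω) → MvPolynomial {i // i ∉ S} Ω}
    (ha : ∀ Q : Ideal (MvPolynomial σ Ω), Q.IsPrime → Q.comap (map (algebraMap K Ω)) = P →
      ∑ x ∈ pts, aeval l (a x) * h x ∈ Q) :
    ∀ x ∈ pts, a x = 0 := by
  classical
  intro x₀ hx₀
  by_contra hne
  have : Infinite Ω := IsAlgClosed.instInfinite
  obtain ⟨j⟩ := (inferInstance : Nonempty {i // i ∉ S})
  -- The extra factor `X j` ensures `v j ≠ 0`, so that the direction `v` can be parametrized by its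
  -- `j`-th coordinate.
  obtain ⟨v, hv⟩ : ∃ v, eval v (a x₀ * X j) ≠ 0 := by
    by_contra! hc
    refine mul_ne_zero hne (X_ne_zero j) (MvPolynomial.funext fun v => ?_)
    rw [map_zero]
    exact hc v
  rw [map_mul, eval_X] at hv
  have hvj : v j ≠ 0 := right_ne_zero_of_mul hv
  -- restriction to the line through the origin with direction `v`
  let α : (σ → Ω) → Polynomial Ω := fun x =>
    aeval (fun i => Polynomial.C (v i) * Polynomial.X) (a x)
  have hα₀ : α x₀ ≠ 0 := by
    intro h
    have h2 : Polynomial.aeval (1 : Ω) (α x₀) = aeval v (a x₀) := by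
      rw [← AlgHom.comp_apply]
      congr 1
      ext i
      simp
    rw [h, map_zero, aeval_eq_eval] at h2
    exact left_ne_zero_of_mul hv h2.symm
  -- `x₁` has the least order of vanishing `r` at the origin along the line, so every `α x` is
  -- divisible by the `r`-th power of the parameter and the cofactor of `α x₁` is nonzero at `0`.
  obtain ⟨x₁, hx₁, hmin⟩ := Finset.exists_min_image (pts.filter fun x => α x ≠ 0)
    (fun x => (α x).natTrailingDegree) ⟨x₀, Finset.mem_filter.2 ⟨hx₀, hα₀⟩⟩
  obtain ⟨hx₁, hα₁⟩ := Finset.mem_filter.1 hx₁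
  set r := (α x₁).natTrailingDegree with hr
  have hdvd : ∀ x, ∃ β : Polynomial Ω, x ∈ pts → α x = Polynomial.X ^ r * β := by
    intro x
    by_cases hx : x ∈ pts
    · have : Polynomial.X ^ r ∣ α x := by
        rw [Polynomial.X_pow_dvd_iff]
        intro m hm
        by_cases hαx : α x = 0
        · rw [hαx, Polynomial.coeff_zero]
        · exact Polynomial.coeff_eq_zero_of_lt_natTrailingDegree
            (hm.trans_le (hmin x (Finset.mem_filter.2 ⟨hx, hαx⟩)))
      obtain ⟨β, hβ⟩ := this
      exact ⟨β, fun _ => hβ⟩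
    · exact ⟨0, fun h => absurd h hx⟩
  choose β hβ using hdvd
  have hβ₁ : (β x₁).coeff 0 ≠ 0 := by
    have h2 : (α x₁).coeff r ≠ 0 := by
      rw [hr]
      exact Polynomial.trailingCoeff_nonzero_iff_nonzero.2 hα₁
    rwa [hβ x₁ hx₁, Polynomial.coeff_X_pow_mul', if_pos le_rfl, Nat.sub_self] at h2
  -- a prime below the maximal ideal of `x₁` containing the equations of the line
  obtain ⟨Q₀, hQ₀, hQ₀M, hQ₀P⟩ :=
    exists_isPrime_comap_map_eq (map_le_vanishingIdeal_singleton (hl.mem x₁ hx₁))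
  have hPQ₀ : P.map (map (algebraMap K Ω)) ≤ Q₀ := Ideal.map_le_iff_le_comap.2 hQ₀P.ge
  obtain ⟨Q, hQ, hQ₀Q, hsQ, hQM⟩ := exists_isPrime_lt_of_card_lt (hInt Q₀ hPQ₀)
    (paramMap_injective_of_comap hinj hQ₀P) hQ₀M
    ((Finset.univ.erase j).image fun i => l i - C (v i / v j) * l j)
    (by
      intro p hp
      obtain ⟨i, -, rfl⟩ := Finset.mem_image.1 hp
      intro y hy
      rw [Set.mem_singleton_iff.1 hy, map_sub, map_mul, hl.vanish x₁ hx₁, hl.vanish x₁ hx₁, mul_zero,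
        sub_zero])
    (by
      refine Finset.card_image_le.trans_lt ?_
      rw [Nat.card_eq_fintype_card, Finset.card_erase_of_mem (Finset.mem_univ j),
        Finset.card_univ]
      have : 0 < Fintype.card {i // i ∉ S} := Fintype.card_pos
      omega)
  let T : MvPolynomial σ Ω := C (v j)⁻¹ * l j
  have hlT : ∀ i, l i - C (v i) * T ∈ Q := by
    intro i
    by_cases hij : i = j
    · subst hij
      have : l i - C (v i) * T = 0 := by
        simp only [T]
        rw [← mul_assoc, ← C_mul, mul_inv_cancel₀ hvj, C_1, one_mul, sub_self]
      rw [this]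
      exact zero_mem _
    · have := hsQ (Finset.mem_image_of_mem _ (Finset.mem_erase.2 ⟨hij, Finset.mem_univ i⟩))
      simp only [T]
      rwa [← mul_assoc, ← C_mul, ← div_eq_mul_inv]
  -- If `T` were in `Q`, all linear forms would be, and the zero locus of `Q` would lie in the
  -- finite slice. Then `Q` would be the maximal ideal of `x₁`, which strictly contains it.
  have hTQ : T ∉ Q := by
    intro hT
    have hlQ : ∀ i, l i ∈ Q := fun i => by
      have := Q.add_mem (hlT i) (Q.mul_mem_left (C (v i)) hT)
      rwa [sub_add_cancel] at this
    have hfin : (zeroLocus Ω Q).Finite := (hl.finite ⟨x₁, hx₁⟩).subset fun y hy =>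
      ⟨mem_zeroLocus_of_map_le (hPQ₀.trans hQ₀Q) hy, fun i => hy _ (hlQ i)⟩
    exact hQM.ne (eq_vanishingIdeal_singleton_of_finite hfin hQM.le)
  have hmk : ∀ p : MvPolynomial {i // i ∉ S} Ω,
      Ideal.Quotient.mkₐ Ω Q (aeval l p) = Ideal.Quotient.mkₐ Ω Q (Polynomial.aeval T
        (aeval (fun i => Polynomial.C (v i) * Polynomial.X : _ → Polynomial Ω) p)) := by
    intro p
    simp only [← AlgHom.comp_apply]
    congr 1
    ext i
    simp only [AlgHom.comp_apply, aeval_X, map_mul, Polynomial.aeval_C, Polynomial.aeval_X]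
    exact Ideal.Quotient.eq.2 (hlT i)
  have hsum := hQ₀Q (ha Q₀ hQ₀ hQ₀P)
  rw [← Ideal.Quotient.eq_zero_iff_mem] at hsum
  have hsum2 : Ideal.Quotient.mk Q
      (T ^ r * ∑ x ∈ pts, Polynomial.aeval T (β x) * h x) = 0 := by
    rw [← hsum, Finset.mul_sum, map_sum, map_sum]
    refine Finset.sum_congr rfl fun x hx => ?_
    rw [map_mul _ (aeval l (a x)), show Ideal.Quotient.mk Q (aeval l (a x)) = _ from hmk (a x)]
    change _ = Ideal.Quotient.mk Q (Polynomial.aeval T (α x)) * _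
    rw [hβ x hx, map_mul (Polynomial.aeval T), map_pow, Polynomial.aeval_X, ← map_mul, mul_assoc]
  rw [Ideal.Quotient.eq_zero_iff_mem] at hsum2
  -- Cancel `T ^ r` modulo the prime `Q` and evaluate at `x₁`: `T` vanishes there and only the `x₁`
  -- term survives, leaving the constant coefficient of `β x₁`.
  have hmem := hQM.le ((hQ.mem_or_mem hsum2).resolve_left fun h => hTQ (hQ.mem_of_pow_mem r h))
    x₁ rfl
  rw [map_sum, Finset.sum_eq_single_of_mem x₁ hx₁] at hmem
  · rw [map_mul, h1 x₁ hx₁, mul_one, ← Polynomial.aeval_algHom_apply] at hmem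
    have hT0 : aeval x₁ T = 0 := by
      simp only [T]
      rw [map_mul, hl.vanish x₁ hx₁, mul_zero]
    rw [hT0, ← Polynomial.coeff_zero_eq_aeval_zero] at hmem
    exact hβ₁ hmem
  · intro x hx hxx
    rw [map_mul, h0 x hx x₁ hx₁ (Ne.symm hxx), mul_zero]

end Slices

/-! ### Counting points of linear sections -/

section Counting

/-- If `B` grows at most polynomially and `N * B s ≤ D * B (s + c)` for all `s`, then `N ≤ D`. -/
theorem le_of_mul_le_mul_add {B : ℕ → ℕ} {m N D c : ℕ} (h0 : 1 ≤ B 0)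
    (hB : ∀ s, B s ≤ (s + 1) ^ m) (h : ∀ s, N * B s ≤ D * B (s + c)) : N ≤ D := by
  by_contra! hlt
  -- Iterating the hypothesis along `s = 0, c, 2c, …` compares the exponential `(N / D) ^ j` with
  -- the polynomial bound on `B (j * c)`.
  have key : ∀ j, N ^ j ≤ D ^ j * B (j * c) := by
    intro j
    induction j with
    | zero => simpa using h0
    | succ j ih =>
      calc N ^ (j + 1) = N * N ^ j := by ring
        _ ≤ N * (D ^ j * B (j * c)) := Nat.mul_le_mul_left _ ih
        _ = D ^ j * (N * B (j * c)) := by ring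
        _ ≤ D ^ j * (D * B (j * c + c)) := Nat.mul_le_mul_left _ (h _)
        _ = D ^ (j + 1) * B ((j + 1) * c) := by rw [add_mul, one_mul]; ring
  rcases Nat.eq_zero_or_pos D with rfl | hD
  · have := key 1
    simp only [pow_one, zero_mul] at this
    omega
  have hDr : (0 : ℝ) < D := by exact_mod_cast hD
  set r : ℝ := N / D with hr
  have hr1 : 1 < r := by rw [hr, one_lt_div hDr]; exact_mod_cast hlt
  have ht := tendsto_pow_const_div_const_pow_of_one_lt m hr1
  have hpos : (0 : ℝ) < 1 / ((c : ℝ) + 1) ^ m := by positivity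
  -- The condition `1 ≤ j` gives `j * c + 1 ≤ j * (c + 1)`, used to bound `B (j * c)`.
  obtain ⟨j, hj1, hj2⟩ := ((ht.eventually (gt_mem_nhds hpos)).and
    (Filter.eventually_ge_atTop 1)).exists
  have h1 : (N : ℝ) ^ j ≤ D ^ j * ((j : ℝ) ^ m * ((c : ℝ) + 1) ^ m) := by
    have h2 : N ^ j ≤ D ^ j * (j ^ m * (c + 1) ^ m) := by
      refine (key j).trans (Nat.mul_le_mul_left _ ((hB _).trans ?_))
      rw [← mul_pow]
      refine Nat.pow_le_pow_left ?_ m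
      nlinarith
    exact_mod_cast h2
  have h3 : r ^ j ≤ (j : ℝ) ^ m * ((c : ℝ) + 1) ^ m := by
    rw [hr, div_pow, div_le_iff₀ (by positivity)]
    linarith
  rw [div_lt_div_iff₀ (by positivity) (by positivity)] at hj1
  linarith

variable {σ : Type*} [Fintype σ]

/-- The exponents of total degree at most `s`. -/
def expsLE (σ : Type*) [Fintype σ] (s : ℕ) : Finset (σ →₀ ℕ) := by
  classical
  exact (Finset.univ.image fun z : σ → Fin (s + 1) =>
    Finsupp.equivFunOnFinite.symm fun i => (z i : ℕ)).filter fun z => ∑ i, z i ≤ s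

theorem mem_expsLE {s : ℕ} {z : σ →₀ ℕ} : z ∈ expsLE σ s ↔ ∑ i, z i ≤ s := by
  classical
  rw [expsLE, Finset.mem_filter]
  refine ⟨fun h => h.2, fun h => ⟨Finset.mem_image.2 ⟨fun i => ⟨z i, ?_⟩, Finset.mem_univ _, ?_⟩,
    h⟩⟩
  · have := Finset.single_le_sum (f := fun i => z i) (fun _ _ => Nat.zero_le _)
      (Finset.mem_univ i)
    omega
  · ext i
    simp

theorem card_expsLE_le (s : ℕ) : (expsLE σ s).card ≤ (s + 1) ^ Fintype.card σ := by
  classical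
  rw [expsLE]
  refine (Finset.card_filter_le _ _).trans (Finset.card_image_le.trans ?_)
  simp

theorem one_le_card_expsLE_zero : 1 ≤ (expsLE σ 0).card :=
  Finset.card_pos.2 ⟨0, mem_expsLE.2 (by simp)⟩

theorem weight_one_eq_sum (e : σ →₀ ℕ) : Finsupp.weight (fun _ : σ => 1) e = ∑ i, e i := by
  rw [Finsupp.weight_apply, Finsupp.sum_fintype _ _ (by simp)]
  simp

variable [DecidableEq σ]

/-- The reduced exponents of total degree at most `s`. -/
def reducedExps (S : Finset σ) (d : σ → ℕ) (s : ℕ) : Finset (σ →₀ ℕ) :=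
  (expsLE σ s).filter fun e => ∀ i ∈ S, e i < d i

theorem card_reducedExps_le (S : Finset σ) (d : σ → ℕ) (s : ℕ) :
    (reducedExps S d s).card ≤ (∏ i ∈ S, d i) * (expsLE {i // i ∉ S} s).card := by
  classical
  have hcard : (∏ i ∈ S, d i) * (expsLE {i // i ∉ S} s).card =
      ((Finset.univ : Finset (∀ i : S, Fin (d i))) ×ˢ expsLE {i // i ∉ S} s).card := by
    rw [Finset.card_product, Finset.card_univ, Fintype.card_pi]
    simp only [Fintype.card_fin]
    rw [Finset.prod_coe_sort S d]
  rw [hcard]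
  refine Finset.card_le_card_of_surjOn (fun z =>
    Finsupp.equivFunOnFinite.symm fun i => if h : i ∈ S then (z.1 ⟨i, h⟩ : ℕ) else z.2 ⟨i, h⟩) ?_
  intro e he
  have he' := Finset.mem_filter.1 he
  refine ⟨(fun i => ⟨e i, he'.2 i i.2⟩, Finsupp.equivFunOnFinite.symm fun i => e i), ?_, ?_⟩
  · refine Finset.mem_product.2 ⟨Finset.mem_univ _, mem_expsLE.2 ?_⟩
    refine le_trans ?_ (mem_expsLE.1 he'.1)
    rw [← Fintype.sum_subtype_add_sum_subtype (fun i => i ∈ S) (fun i => e i)]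
    simp
  · ext i
    simp

end Counting

/-! ### Degree bounds for spanning sets and products -/

section Span

variable {k : Type*} [Field k] {σ : Type*} [Fintype σ] [DecidableEq σ]

/-- Division by the system does not raise total degree. This is the upper bound on dimensions in the
Bézout count. -/
theorem IsTriangular.mk_mem_span {S : Finset σ} {d : σ → ℕ} {f : σ → MvPolynomial σ k}
    (hf : IsTriangular (fun _ => 1) S d f) {s : ℕ} {p : MvPolynomial σ k}
    (hp : p ∈ weightLT k (fun _ => 1) (s + 1)) :
    Ideal.Quotient.mkₐ k (Ideal.span (f '' S)) p ∈ Submodule.span k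
      ((fun e => Ideal.Quotient.mkₐ k (Ideal.span (f '' S)) (monomial e 1)) ''
        (reducedExps S d s : Set (σ →₀ ℕ))) := by
  obtain ⟨r, hr, hrN, hpr⟩ := hf.exists_remainder hp
  have : Ideal.Quotient.mkₐ k (Ideal.span (f '' (S : Set σ))) p =
    Ideal.Quotient.mkₐ k (Ideal.span (f '' (S : Set σ))) r := Ideal.Quotient.eq.2 hpr
  rw [this, r.as_sum, map_sum]
  refine sum_mem fun e he => ?_
  have h : monomial e (coeff e r) = coeff e r • monomial e (1 : k) := by
    rw [smul_monomial, smul_eq_mul, mul_one]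
  rw [h, map_smul]
  refine Submodule.smul_mem _ _ (Submodule.subset_span ⟨e, ?_, rfl⟩)
  refine Finset.mem_coe.2 (Finset.mem_filter.2 ⟨mem_expsLE.2 ?_, hr e he⟩)
  have := hrN he
  simp only [Set.mem_ofPred_eq, weight_one_eq_sum] at this
  omega

theorem prod_pow_mem_weightLT {τ : Type*} [Fintype τ] {l : τ → MvPolynomial σ k}
    (hl : ∀ i, l i ∈ weightLT k (fun _ => 1) 2) (z : τ →₀ ℕ) :
    ∏ i, l i ^ z i ∈ weightLT k (fun _ => 1) ((∑ i, z i) + 1) := by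
  classical
  have h1 : (1 : MvPolynomial σ k) ∈ weightLT k (fun _ => 1) 1 := by
    have := monomial_mem_weightLT (w := fun _ : σ => 1) 0 (1 : k)
    rwa [map_zero] at this
  have hpow : ∀ i n, l i ^ n ∈ weightLT k (fun _ => 1) (n + 1) := by
    intro i n
    induction n with
    | zero => simpa using h1
    | succ n ih =>
      rw [pow_succ]
      exact mul_mem_weightLT (a := n) (b := 2) ih (hl i)
  suffices ∀ s : Finset τ, ∏ i ∈ s, l i ^ z i ∈ weightLT k (fun _ => 1) ((∑ i ∈ s, z i) + 1) from
    this _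
  intro s
  induction s using Finset.induction_on with
  | empty => simpa using h1
  | insert a s ha ih =>
    rw [Finset.prod_insert ha, Finset.sum_insert ha, add_assoc]
    exact mul_mem_weightLT (hpow a _) ih

end Span

/-! ### Bézout's inequality by comparing growth -/

section Bezout

variable {K : Type*} [Field K] {Ω : Type*} [Field Ω] [Algebra K Ω] [IsAlgClosed Ω]
  [Algebra.IsAlgebraic K Ω] {σ : Type*} [Fintype σ] [DecidableEq σ]

/-- Bézout's inequality for the slices of finitely many components of a triangular system. -/
theorem sum_card_le_prod {S : Finset σ} [Nonempty {i // i ∉ S}] {d : σ → ℕ}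
    {f : σ → MvPolynomial σ Ω} (hf : IsTriangular (fun _ => 1) S d f)
    {κ : Type*} [Fintype κ] [DecidableEq κ] {P : κ → Ideal (MvPolynomial σ K)}
    (hP : ∀ c, (P c).IsPrime)
    (hJ : ∀ c, Ideal.span (f '' S) ≤ (P c).map (map (algebraMap K Ω)))
    (hinj : ∀ c, (P c).comap (rename (Subtype.val : {i // i ∉ S} → σ) : _ →ₐ[K] _) = ⊥)
    (hne : ∀ c c', c ≠ c' → ¬ P c ≤ P c')
    {pts : κ → Finset (σ → Ω)} {l : κ → {i // i ∉ S} → MvPolynomial σ Ω}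
    (hl : ∀ c, IsSlice (P c) (pts c) (l c)) :
    ∑ c, (pts c).card ≤ ∏ i ∈ S, d i := by
  classical
  -- polynomials separating the components
  have hq : ∀ c, ∃ q : MvPolynomial σ K, q ∉ P c ∧ ∀ c', c' ≠ c → q ∈ P c' := by
    intro c
    have : ∀ c', ∃ p, c' ≠ c → p ∈ P c' ∧ p ∉ P c := by
      intro c'
      by_cases h : c' = c
      · exact ⟨0, fun h' => absurd h h'⟩
      · obtain ⟨p, hp⟩ := Set.not_subset.1 (hne c' c h)
        exact ⟨p, fun _ => hp⟩
    choose p hp using this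
    refine ⟨∏ c' ∈ Finset.univ.erase c, p c', fun h => ?_, fun c' hc' => ?_⟩
    · obtain ⟨c', hc', h'⟩ := ((hP c).prod_mem_iff).1 h
      exact (hp c' (Finset.ne_of_mem_erase hc')).2 h'
    · exact Ideal.prod_mem _ (Finset.mem_erase.2 ⟨hc', Finset.mem_univ _⟩) (hp c' hc').1
  choose q hqn hqm using hq
  choose h h1 h0 using fun (c : κ) (x : σ → Ω) => exists_eval_eq_one_and_eq_zero (pts c) x
  set J := Ideal.span (f '' (S : Set σ)) with hJdef
  -- The factor `q` isolates the component `c`; the factor `h` isolates the point `x` within its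
  -- slice.
  let u : (Σ c, pts c) → MvPolynomial σ Ω := fun x => map (algebraMap K Ω) (q x.1) * h x.1 x.2
  have hM : ∃ M, ∀ x, u x ∈ weightLT Ω (fun _ => 1) (M + 1) := by
    choose M hM using fun x => exists_mem_weightLT (fun _ => 1) (u x)
    exact ⟨∑ x, M x, fun x => weightLT_mono
      ((Finset.single_le_sum (fun _ _ => Nat.zero_le _) (Finset.mem_univ x)).trans
        (Nat.le_succ _)) (hM x)⟩
  obtain ⟨M, hM⟩ := hM
  have hcard : ∑ c, (pts c).card = Fintype.card (Σ c, pts c) := by simp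
  rw [hcard]
  refine le_of_mul_le_mul_add (B := fun s => (expsLE {i // i ∉ S} s).card) (c := M)
    one_le_card_expsLE_zero card_expsLE_le fun s => ?_
  refine le_trans ?_ (card_reducedExps_le S d (s + M))
  let v : (Σ c, pts c) × expsLE {i // i ∉ S} s → MvPolynomial σ Ω ⧸ J := fun y =>
    Ideal.Quotient.mkₐ Ω J ((∏ i, l y.1.1 i ^ (y.2 : {i // i ∉ S} →₀ ℕ) i) * u y.1)
  have hv : LinearIndependent Ω v := by
    rw [Fintype.linearIndependent_iff]
    intro g hg
    let a : (Σ c, pts c) → MvPolynomial {i // i ∉ S} Ω := fun x =>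
      ∑ z : expsLE {i // i ∉ S} s, monomial (z : {i // i ∉ S} →₀ ℕ) (g (x, z))
    have hsum : ∑ x, aeval (l x.1) (a x) * u x ∈ J := by
      rw [← Ideal.Quotient.eq_zero_iff_mem, ← hg, Fintype.sum_prod_type, map_sum]
      refine Finset.sum_congr rfl fun x _ => ?_
      rw [map_sum (aeval (l x.1)), Finset.sum_mul, map_sum]
      refine Finset.sum_congr rfl fun z _ => ?_
      rw [← map_smul]
      change Ideal.Quotient.mk J _ = Ideal.Quotient.mk J _
      congr 1
      rw [aeval_monomial, Finsupp.prod_fintype _ _ fun i => pow_zero _, Algebra.smul_def]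
      ring
    suffices ha : ∀ x, a x = 0 by
      rintro ⟨x, z⟩
      have := congr_arg (coeff (z : {i // i ∉ S} →₀ ℕ)) (ha x)
      simp only [a] at this
      rw [coeff_sum, Finset.sum_eq_single z, coeff_monomial, if_pos rfl, coeff_zero] at this
      · exact this
      · intro z' _ hz'
        rw [coeff_monomial, if_neg fun h => hz' (Subtype.ext h)]
      · exact fun h => absurd (Finset.mem_univ _) h
    rintro ⟨c, x, hx⟩
    have := hP c
    let b : (σ → Ω) → MvPolynomial {i // i ∉ S} Ω := fun y =>
      if hy : y ∈ pts c then a ⟨c, y, hy⟩ else 0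
    have hb := (hl c).eq_zero (S := S) (h := h c) (a := b) (fun Q hQ => ?_) (hinj c)
      (fun y _ => h1 c y) (fun y _ y' hy' hne => h0 c y y' hy' hne) (fun Q hQ hQP => ?_) x hx
    · simpa only [b, dif_pos hx] using hb
    · refine paramMap_isIntegral (d := d) fun p => ?_
      obtain ⟨N, hN⟩ := exists_mem_weightLT (fun _ => 1) p
      obtain ⟨r, hr, -, hpr⟩ := hf.exists_remainder hN
      exact ⟨r, hr, hQ (hJ c hpr)⟩
    · have hPQ : (P c).map (map (algebraMap K Ω)) ≤ Q := Ideal.map_le_iff_le_comap.2 hQP.ge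
      have hmem := hPQ (hJ c hsum)
      rw [Fintype.sum_sigma, ← Finset.add_sum_erase _ _ (Finset.mem_univ c)] at hmem
      have hrest : ∑ c' ∈ Finset.univ.erase c, ∑ y : pts c',
          aeval (l c') (a ⟨c', y⟩) * u ⟨c', y⟩ ∈ Q := by
        -- The terms of the other components carry a factor `q c' ∈ P c` and vanish modulo `Q`;
        -- afterwards `q c`, which is outside `Q`, is cancelled.
        refine sum_mem fun c' hc' => sum_mem fun y _ => ?_
        refine Ideal.mul_mem_left _ _ (Ideal.mul_mem_right _ _ (hPQ (Ideal.mem_map_of_mem _ ?_)))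
        exact hqm c' c (Finset.ne_of_mem_erase hc').symm
      have hmain := (Ideal.add_mem_iff_left Q hrest).1 hmem
      have heq : ∑ y : pts c, aeval (l c) (a ⟨c, y⟩) * u ⟨c, y⟩ =
          map (algebraMap K Ω) (q c) * ∑ y ∈ pts c, aeval (l c) (b y) * h c y := by
        rw [Finset.mul_sum, ← Finset.sum_coe_sort (pts c)]
        refine Finset.sum_congr rfl fun y _ => ?_
        simp only [b, u, dif_pos y.2]
        ring
      rw [heq] at hmain
      refine (hQ.mem_or_mem hmain).resolve_left fun hq' => hqn c ?_
      rw [← hQP]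
      exact hq'
  have hle := linearIndependent_le_span' v hv
    ((fun e => Ideal.Quotient.mkₐ Ω J (monomial e 1)) ''
        (reducedExps S d (s + M) : Set (σ →₀ ℕ))) (by
      rintro _ ⟨y, rfl⟩
      refine hf.mk_mem_span ?_
      have h2 := mul_mem_weightLT (prod_pow_mem_weightLT (hl y.1.1).linear y.2.1) (hM y.1)
      refine weightLT_mono ?_ h2
      have := mem_expsLE.1 y.2.2
      omega)
  rw [Cardinal.mk_fintype, Nat.cast_le, Fintype.card_prod, Fintype.card_coe] at hle
  refine hle.trans ?_
  rw [← Set.toFinset_card, Set.toFinset_image]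
  refine Finset.card_image_le.trans ?_
  simp

end Bezout

/-! ### Varieties defined by triangular systems -/

section TriangularVariety

variable {K : Type*} [Field K] {σ : Type*} [Fintype σ] [DecidableEq σ] {w : σ → ℕ}
  {S : Finset σ} {d : σ → ℕ} {f : σ → MvPolynomial σ K}

theorem IsTriangular.map {Ω : Type*} [Field Ω] (φ : K →+* Ω) (hf : IsTriangular w S d f) :
    IsTriangular w S d fun i => MvPolynomial.map φ (f i) := by
  intro i hi
  obtain ⟨hd, h⟩ := hf i hi
  refine ⟨hd, fun e he => h ?_⟩
  have h2 : MvPolynomial.map φ (f i) - monomial (Finsupp.single i (d i)) 1 =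
      MvPolynomial.map φ (f i - monomial (Finsupp.single i (d i)) 1) := by
    rw [map_sub, map_monomial, map_one φ]
  rw [h2] at he
  exact support_map_subset φ _ he

theorem IsTriangular.paramMap_isIntegral (hf : IsTriangular w S d f)
    {J : Ideal (MvPolynomial σ K)} (hJ : Ideal.span (f '' S) ≤ J) :
    (paramMap S J).IsIntegral := by
  refine DiagonalSystem.paramMap_isIntegral (d := d) fun p => ?_
  obtain ⟨N, hN⟩ := exists_mem_weightLT w p
  obtain ⟨r, hr, -, hpr⟩ := hf.exists_remainder hN
  exact ⟨r, hr, hJ hpr⟩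

/-- Elements of a minimal prime are zero divisors modulo the ideal, whereas nonzero polynomials in
the free variables are regular modulo a triangular system. -/
theorem IsTriangular.comap_rename_eq_bot (hf : IsTriangular w S d f)
    {P : Ideal (MvPolynomial σ K)} (hP : P ∈ (Ideal.span (f '' S)).minimalPrimes) :
    P.comap (rename (Subtype.val : {i // i ∉ S} → σ) : _ →ₐ[K] _) = ⊥ := by
  rw [eq_bot_iff]
  intro r hr
  by_contra hr0
  have hr0' : rename (Subtype.val : {i // i ∉ S} → σ) r ≠ 0 := fun h =>
    hr0 (rename_injective _ Subtype.val_injective (by rw [h, map_zero]))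
  obtain ⟨y, hy, hxy⟩ := Ideal.exists_mul_mem_of_mem_minimalPrimes hP hr
  refine hy (hf.mem_of_mul_mem hr0' (fun c hc i hi => ?_) hxy)
  obtain ⟨u, rfl, -⟩ := coeff_rename_ne_zero _ _ _ (mem_support_iff.1 hc)
  exact Finsupp.mapDomain_of_notMem_range _ _ fun ⟨j, hj⟩ => j.2 (hj ▸ hi)

theorem IsTriangular.paramMap_injective (hf : IsTriangular w S d f)
    {P : Ideal (MvPolynomial σ K)} (hP : P ∈ (Ideal.span (f '' S)).minimalPrimes) :
    Function.Injective (paramMap S P) := by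
  rw [injective_iff_map_eq_zero]
  intro p hp
  have hp' : p ∈ P.comap (rename (Subtype.val : {i // i ∉ S} → σ) : _ →ₐ[K] _) :=
    Ideal.mem_comap.2 (Ideal.Quotient.eq_zero_iff_mem.1 hp)
  rwa [hf.comap_rename_eq_bot hP] at hp'

variable {Ω : Type*} [Field Ω] [Algebra K Ω]

theorem isVariety_of_mem_components {V C : Set (σ → Ω)} (hC : C ∈ components K V) :
    IsVariety K C :=
  (show Maximal (fun W => IsIrredVariety K W ∧ W ⊆ V) C from hC).prop.1.1

variable [IsAlgClosed Ω]

theorem IsTriangular.dim_component (hf : IsTriangular w S d f) {C : Set (σ → Ω)}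
    (hC : C ∈ components K (zeroLocus Ω (Ideal.span (f '' S)))) :
    dim K C = Nat.card {i // i ∉ S} := by
  have hP := vanishingIdeal_mem_minimalPrimes hC
  have := hP.1.1
  have hC' : C = zeroLocus Ω (vanishingIdeal K C) :=
    (isVariety_of_mem_components hC).zeroLocus_vanishingIdeal.symm
  rw [hC', dim_zeroLocus]
  exact ringKrullDim_quotient_eq (hf.paramMap_isIntegral hP.1.2) (hf.paramMap_injective hP)

/-- A linear section of a variety, as a slice. -/
theorem exists_isSlice {τ : Type*} [Fintype τ] {P : Ideal (MvPolynomial σ K)}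
    {L : AffineSubspace Ω (σ → Ω)}
    (hL : Module.finrank Ω L.direction + Fintype.card τ = Fintype.card σ)
    (hfin : (zeroLocus Ω P ∩ L).Finite) :
    ∃ l : τ → MvPolynomial σ Ω, IsSlice P hfin.toFinset l := by
  -- An empty section provides no base point for the affine forms. The zero forms then suffice,
  -- since `IsSlice` requires finiteness only when there are points.
  rcases Set.eq_empty_or_nonempty (zeroLocus Ω P ∩ (L : Set (σ → Ω))) with h | ⟨x₀, hx₀⟩
  · have h' : hfin.toFinset = ∅ := by simp [h]
    rw [h']
    exact ⟨0, fun _ => zero_mem _, by simp, by simp, by simp⟩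
  have hfr : Module.finrank Ω ((σ → Ω) ⧸ L.direction) = Fintype.card τ := by
    have := L.direction.finrank_quotient_add_finrank
    rw [Module.finrank_fintype_fun_eq_card] at this
    omega
  let b : Module.Basis τ Ω ((σ → Ω) ⧸ L.direction) :=
    (Module.finBasisOfFinrankEq Ω _ hfr).reindex (Fintype.equivFin τ).symm
  let φ : τ → Module.Dual Ω (σ → Ω) := fun i => b.coord i ∘ₗ L.direction.mkQ
  let l : τ → MvPolynomial σ Ω := fun i =>
    ∑ j, C (φ i (Pi.single j 1)) * X j - C (φ i x₀)
  have hev : ∀ x i, aeval x (l i) = φ i (x - x₀) := by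
    intro x i
    rw [map_sub (φ i), map_sub, map_sum, aeval_C]
    congr 1
    conv_rhs => rw [LinearMap.pi_apply_eq_sum_univ (φ i) x]
    refine Finset.sum_congr rfl fun j _ => ?_
    have hj : (Pi.single j 1 : σ → Ω) = fun a => if j = a then 1 else 0 := by
      ext a
      simp [Pi.single_apply, eq_comm]
    rw [map_mul, aeval_C, aeval_X, smul_eq_mul, mul_comm, hj]
    rfl
  have hmem : ∀ x, x ∈ L ↔ ∀ i, aeval x (l i) = 0 := by
    intro x
    rw [← AffineSubspace.vsub_right_mem_direction_iff_mem hx₀.2, vsub_eq_sub,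
      ← Submodule.Quotient.mk_eq_zero, ← b.forall_coord_eq_zero_iff]
    simp only [hev]
    rfl
  refine ⟨l, fun i => ?_, fun x hx => (hfin.mem_toFinset.1 hx).1,
    fun x hx => (hmem x).1 (hfin.mem_toFinset.1 hx).2, fun _ => ?_⟩
  · refine sub_mem (sum_mem fun j _ => ?_) ?_
    · have := monomial_mem_weightLT (w := fun _ : σ => 1) (Finsupp.single j 1)
        (φ i (Pi.single j 1))
      rwa [Finsupp.weight_single, ← C_mul_X_eq_monomial] at this
    · have := monomial_mem_weightLT (w := fun _ : σ => 1) 0 (φ i x₀)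
      rw [map_zero] at this
      exact weightLT_mono one_le_two this
  · refine hfin.subset fun x hx => ⟨hx.1, (hmem x).2 hx.2⟩

theorem exists_isSlice_of_le_degIrred {τ : Type*} [Fintype τ] {P : Ideal (MvPolynomial σ K)}
    (hdim : dim K (zeroLocus Ω P) = Fintype.card τ) {N : ℕ}
    (hN : (N : ℕ∞) ≤ degIrred K (zeroLocus Ω P)) :
    ∃ (pts : Finset (σ → Ω)) (l : τ → MvPolynomial σ Ω), IsSlice P pts l ∧ N ≤ pts.card := by
  rcases Nat.eq_zero_or_pos N with rfl | hpos
  · exact ⟨∅, 0, ⟨fun _ => zero_mem _, by simp, by simp, by simp⟩, Nat.zero_le _⟩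
  have hlt : ((N - 1 : ℕ) : ℕ∞) < degIrred K (zeroLocus Ω P) := by
    refine lt_of_lt_of_le ?_ hN
    exact_mod_cast Nat.sub_lt hpos one_pos
  rw [degIrred, lt_iSup_iff] at hlt
  obtain ⟨L, hlt⟩ := hlt
  obtain ⟨⟨hL, hfin⟩, hlt⟩ := lt_iSup_iff.1 hlt
  rw [hdim] at hL
  have hL' : Module.finrank Ω L.direction + Fintype.card τ = Fintype.card σ := by
    exact_mod_cast hL
  obtain ⟨l, hl⟩ := exists_isSlice (P := P) hL' hfin
  refine ⟨_, l, hl, ?_⟩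
  rw [hfin.encard_eq_coe_toFinset_card] at hlt
  have : N - 1 < hfin.toFinset.card := by exact_mod_cast hlt
  omega

/-- The degrees are not yet known to be finite, so each is truncated at `D + 1`; a single truncated
term already exceeds `D`. -/
theorem exists_nat_le_of_lt_sum {ι : Type*} (s : Finset ι) (a : ι → ℕ∞) {D : ℕ}
    (h : (D : ℕ∞) < ∑ i ∈ s, a i) :
    ∃ N : ι → ℕ, (∀ i, (N i : ℕ∞) ≤ a i) ∧ D < ∑ i ∈ s, N i := by
  have hN : ∀ i, ((min (a i) (D + 1 : ℕ)).toNat : ℕ∞) = min (a i) (D + 1 : ℕ) := fun i =>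
    ENat.natCast_toNat (ne_top_of_le_ne_top (ENat.natCast_ne_top _) (min_le_right _ _))
  refine ⟨fun i => (min (a i) (D + 1 : ℕ)).toNat, fun i => (hN i).le.trans (min_le_left _ _), ?_⟩
  have : (D : ℕ∞) < ((∑ i ∈ s, (min (a i) (D + 1 : ℕ)).toNat : ℕ) : ℕ∞) := by
    rw [Nat.cast_sum]
    simp only [hN]
    by_cases hbig : ∃ i ∈ s, ((D + 1 : ℕ) : ℕ∞) ≤ a i
    · obtain ⟨i, hi, hle⟩ := hbig
      refine lt_of_lt_of_le ?_ (Finset.single_le_sum (fun _ _ => bot_le) hi)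
      rw [min_eq_right hle]
      exact_mod_cast Nat.lt_succ_self D
    · push Not at hbig
      rwa [Finset.sum_congr rfl fun i hi => min_eq_left (hbig i hi).le]
  exact_mod_cast this

variable [Algebra.IsAlgebraic K Ω]

/-- **Bézout's inequality** for a triangular system of polynomials with respect to the total
degree. -/
theorem IsTriangular.deg_le [Nonempty {i // i ∉ S}] (hf : IsTriangular (fun _ => 1) S d f) :
    deg K (zeroLocus Ω (Ideal.span (f '' S))) ≤ ((∏ i ∈ S, d i : ℕ) : ℕ∞) := by
  classical
  refine iSup₂_le fun s hs => ?_
  by_contra! hlt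
  obtain ⟨N, hN, hsum⟩ := exists_nat_le_of_lt_sum s _ hlt
  let P : s → Ideal (MvPolynomial σ K) := fun C => vanishingIdeal K C.1
  have hP : ∀ C, P C ∈ (Ideal.span (f '' (S : Set σ))).minimalPrimes := fun C =>
    vanishingIdeal_mem_minimalPrimes (hs C.2)
  have hPC : ∀ C : s, zeroLocus Ω (P C) = C.1 := fun C =>
    (isVariety_of_mem_components (hs C.2)).zeroLocus_vanishingIdeal
  have hslice : ∀ C : s, ∃ (pts : Finset (σ → Ω)) (l : {i // i ∉ S} → MvPolynomial σ Ω),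
      IsSlice (P C) pts l ∧ N C ≤ pts.card := by
    intro C
    refine exists_isSlice_of_le_degIrred ?_ ?_
    · rw [hPC, hf.dim_component (hs C.2), Nat.card_eq_fintype_card]
    · rw [hPC]
      exact hN C
  choose pts l hl hcard using hslice
  have hspan : Ideal.span ((fun i => MvPolynomial.map (algebraMap K Ω) (f i)) '' (S : Set σ)) =
      (Ideal.span (f '' (S : Set σ))).map (MvPolynomial.map (algebraMap K Ω)) := by
    rw [Ideal.map_span, Set.image_image]
  have hle := sum_card_le_prod (hf.map (algebraMap K Ω)) (P := P) (fun C => (hP C).1.1)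
    (fun C => by rw [hspan]; exact Ideal.map_mono (hP C).1.2)
    (fun C => hf.comap_rename_eq_bot (hP C)) (fun C C' hne hle => hne ?_) hl
  · have h1 : ∑ C ∈ s, N C ≤ ∑ C, (pts C).card := by
      rw [← Finset.sum_coe_sort]
      exact Finset.sum_le_sum fun C _ => hcard C
    omega
  · have heq : P C = P C' := le_antisymm hle ((hP C').2 (hP C).1 hle)
    apply Subtype.ext
    rw [← hPC, heq, hPC]

end TriangularVariety

/-! ### Polynomials vanishing on the variety of a system `X i ^ d i = u i` -/

section Vanishing

variable {K : Type*} [Field K] {Ω : Type*} [Field Ω] [Algebra K Ω] [IsAlgClosed Ω]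
  {σ : Type*} [Fintype σ] [DecidableEq σ] {w : σ → ℕ} {S : Finset σ} {d : σ → ℕ}
  {f : σ → MvPolynomial σ K}

theorem aeval_congr_of_mem_supported {s : Set σ} {p : MvPolynomial σ K}
    (hp : p ∈ supported K s) {E : Type*} [CommRing E] [Algebra K E] {x y : σ → E}
    (h : ∀ i ∈ s, x i = y i) : aeval x p = aeval y p :=
  hom_congr_vars (f₁ := (aeval x : MvPolynomial σ K →ₐ[K] E).toRingHom)
    (f₂ := (aeval y : MvPolynomial σ K →ₐ[K] E).toRingHom) (by ext; simp)
    (fun i hi _ => by simpa using h i (mem_supported.1 hp hi)) rfl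

theorem exists_finset_card_eq_pow_eq {n : ℕ} (hn : (n : Ω) ≠ 0) {a : Ω} (ha : a ≠ 0) :
    ∃ Z : Finset Ω, Z.card = n ∧ ∀ z ∈ Z, z ^ n = a := by
  classical
  refine ⟨(Polynomial.X ^ n - Polynomial.C a : Polynomial Ω).roots.toFinset, ?_, fun z hz => ?_⟩
  · rw [Multiset.toFinset_card_of_nodup
      (Polynomial.nodup_roots (Polynomial.separable_X_pow_sub_C a hn ha)),
      ← (IsAlgClosed.splits (Polynomial.X ^ n - Polynomial.C a)).natDegree_eq_card_roots,
      Polynomial.natDegree_X_pow_sub_C]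
  · have := (Polynomial.mem_roots'.1 (Multiset.mem_toFinset.1 hz)).2
    simpa [sub_eq_zero] using this

theorem eq_zero_of_isReducedPoly_of_aeval_eq_zero (hd : ∀ i ∈ S, ((d i : ℕ) : Ω) ≠ 0)
    (hu : ∀ i ∈ S, X i ^ d i - f i ∈ supported K ((S : Set σ)ᶜ)) {r : MvPolynomial σ K}
    (hr : IsReducedPoly S d r)
    (hV : ∀ x ∈ zeroLocus Ω (Ideal.span (f '' S)), aeval x r = 0) {x : σ → Ω}
    (hx : ∀ i ∈ S, aeval x (X i ^ d i - f i) ≠ 0) : aeval x r = 0 := by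
  classical
  -- Specializing the variables outside `S` to the coordinates of `x` leaves a polynomial in the
  -- `S`-variables over `Ω`.
  let γ : σ → MvPolynomial σ Ω := fun j => if j ∈ S then X j else C (x j)
  have hγ : ∀ y : σ → Ω, (∀ j ∉ S, y j = x j) → eval y (aeval γ r) = aeval y r := by
    intro y hy
    rw [← aeval_eq_eval, ← AlgHom.restrictScalars_apply K, ← AlgHom.comp_apply]
    congr 1
    ext j
    simp only [AlgHom.comp_apply, aeval_X, AlgHom.restrictScalars_apply, γ]
    split_ifs with hj
    · rw [aeval_X]
    · rw [aeval_C, hy j hj]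
      rfl
  have hZ : ∀ i, ∃ Z : Finset Ω, (i ∈ S → Z.card = d i ∧
      ∀ z ∈ Z, z ^ d i = aeval x (X i ^ d i - f i)) ∧ (i ∉ S → Z = {x i}) := by
    intro i
    by_cases hi : i ∈ S
    · obtain ⟨Z, hZ⟩ := exists_finset_card_eq_pow_eq (hd i hi) (hx i hi)
      exact ⟨Z, fun _ => hZ, fun h => absurd hi h⟩
    · exact ⟨{x i}, fun h => absurd h hi, fun _ => rfl⟩
  choose Z hZ1 hZ2 using hZ
  -- The specialized remainder vanishes on the grid `∏ Z i`. Its degree in `X i` is less than `d i =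
  -- (Z i).card` for `i ∈ S`, and zero for `i ∉ S`, where `Z i` is a singleton.
  have hzero : aeval γ r = 0 := by
    refine eq_zero_of_eval_zero_at_prod_finset _ Z (fun i => ?_) fun y hy => ?_
    · have hdeg : ∀ e ∈ r.support, degreeOf i (aeval γ (monomial e (coeff e r))) < (Z i).card := by
        intro e he
        rw [aeval_monomial, Finsupp.prod_fintype _ _ fun i => pow_zero _]
        have h1 : degreeOf i (∏ j, γ j ^ e j) ≤ ∑ j, e j * degreeOf i (γ j) :=
          (degreeOf_prod_le i _ _).trans
            (Finset.sum_le_sum fun j _ => degreeOf_pow_le i (γ j) (e j))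
        have h2 : degreeOf i (algebraMap K (MvPolynomial σ Ω) (coeff e r)) = 0 :=
          degreeOf_C (algebraMap K Ω (coeff e r)) i
        refine (degreeOf_mul_le i _ _).trans_lt ?_
        rw [h2, zero_add]
        refine h1.trans_lt ?_
        rw [Finset.sum_eq_single i]
        · by_cases hi : i ∈ S
          · simp only [γ, if_pos hi, degreeOf_X_self, mul_one]
            rw [(hZ1 i hi).1]
            exact hr e he i hi
          · simp only [γ, if_neg hi, degreeOf_C, mul_zero]
            rw [hZ2 i hi]
            simp
        · intro j _ hji
          by_cases hj : j ∈ S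
          · simp only [γ, if_pos hj, degreeOf_X, if_neg (Ne.symm hji), mul_zero]
          · simp only [γ, if_neg hj, degreeOf_C, mul_zero]
        · exact fun h => absurd (Finset.mem_univ i) h
      have hpos : 0 < (Z i).card := by
        by_cases hi : i ∈ S
        · rw [(hZ1 i hi).1]
          exact Nat.pos_of_ne_zero fun h => hd i hi (by simp [h])
        · rw [hZ2 i hi]
          simp
      rw [r.as_sum, map_sum]
      refine (degreeOf_sum_le i _ _).trans_lt ?_
      rw [Finset.sup_lt_iff (by simpa using hpos)]
      exact hdeg
    · have hyx : ∀ j ∉ S, y j = x j := fun j hj => by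
        have := hy j
        rw [hZ2 j hj] at this
        exact Finset.mem_singleton.1 this
      rw [hγ y hyx]
      refine hV y ?_
      rw [zeroLocus_span]
      rintro _ ⟨i, hi, rfl⟩
      have h1 := (hZ1 i hi).2 (y i) (hy i)
      rw [← aeval_congr_of_mem_supported (hu i hi) (x := y) (fun j hj => hyx j hj), map_sub,
        map_pow, aeval_X] at h1
      exact sub_eq_self.1 h1.symm
  rw [← hγ x fun _ _ => rfl, hzero, map_zero]

/-- The ideal of a system `X i ^ d i = u i`, `i ∈ S`, where the `u i ≠ 0` are polynomials in the
other variables and the exponents are invertible, contains all polynomials vanishing on the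
variety of the system. -/
theorem IsTriangular.vanishingIdeal_le (hf : IsTriangular w S d f)
    (hd : ∀ i ∈ S, ((d i : ℕ) : Ω) ≠ 0)
    (hu : ∀ i ∈ S, X i ^ d i - f i ∈ supported K ((S : Set σ)ᶜ))
    (hu0 : ∀ i ∈ S, X i ^ d i - f i ≠ 0) :
    vanishingIdeal K (zeroLocus Ω (Ideal.span (f '' S))) ≤ Ideal.span (f '' S) := by
  intro p hp
  obtain ⟨N, hN⟩ := exists_mem_weightLT w p
  obtain ⟨r, hr, -, hpr⟩ := hf.exists_remainder hN
  have hV : ∀ x ∈ zeroLocus Ω (Ideal.span (f '' S)), aeval x r = 0 := by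
    intro x hx
    have h1 := hx _ hpr
    rwa [map_sub, hp x hx, zero_sub, neg_eq_zero] at h1
  suffices r = 0 by rwa [this, sub_zero] at hpr
  -- Where some `u i` vanishes the product of the `u i` does, and elsewhere `r` does; a polynomial
  -- zero at all points of the infinite field `Ω` is zero.
  have hprod : (∏ i ∈ S, (X i ^ d i - f i)) * r = 0 := by
    apply map_injective (algebraMap K Ω) (algebraMap K Ω).injective
    have : Infinite Ω := IsAlgClosed.instInfinite
    refine MvPolynomial.funext fun x => ?_
    rw [map_zero, map_zero, ← aeval_eq_eval, aeval_map_algebraMap, map_mul, map_prod]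
    by_cases hx : ∀ i ∈ S, aeval x (X i ^ d i - f i) ≠ 0
    · rw [eq_zero_of_isReducedPoly_of_aeval_eq_zero hd hu hr hV hx, mul_zero]
    · push Not at hx
      obtain ⟨i, hi, h⟩ := hx
      rw [Finset.prod_eq_zero hi h, zero_mul]
  exact (mul_eq_zero.1 hprod).resolve_left (Finset.prod_ne_zero_iff.2 hu0)

end Vanishing

/-! ### Solving the diagonal system for `n` of the variables -/

section Reduction

variable {F : Type*} [Field F] {n t : ℕ}

/-- The polynomial `X i ^ d i + ∑ j ∉ S, c i j X j ^ d j - b i`. -/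
def solvedPoly (d : Fin t → ℕ) (S : Finset (Fin t)) (c : Fin t → Fin t → F)
    (b : Fin t → MvPolynomial (Fin t) F) (i : Fin t) : MvPolynomial (Fin t) F :=
  X i ^ d i + ∑ j ∈ Sᶜ, C (c i j) * X j ^ d j - b i

theorem isUnit_of_rank_eq {A : Matrix (Fin n) (Fin n) F} (h : A.rank = n) : IsUnit A := by
  rw [← Matrix.mulVec_surjective_iff_isUnit]
  have : LinearMap.range A.mulVecLin = ⊤ := by
    apply Submodule.eq_top_of_finrank_eq
    rw [← Matrix.rank, h, Module.finrank_fin_fun]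
  exact LinearMap.range_eq_top.1 this

theorem HypH.isUnit_submatrix {A : Matrix (Fin n) (Fin t) F} (hA : HypH A) (e : Fin n ↪o Fin t) :
    IsUnit (A.submatrix id e) := isUnit_of_rank_eq (hA e)

/-- Column exchange: if the entry were zero, row `l` of `N` would annihilate the block of `A` with
column `e l` replaced by `j`. That block is invertible, so the row would be zero, contradicting
`hN`. -/
theorem HypH.mul_apply_ne_zero {A : Matrix (Fin n) (Fin t) F} (hA : HypH A) (e : Fin n ↪o Fin t)
    {N : Matrix (Fin n) (Fin n) F} (hN : N * A.submatrix id e = 1) (l : Fin n) {j : Fin t}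
    (hj : j ∉ Set.range e) : (N * A) l j ≠ 0 := by
  classical
  intro h0
  let S : Finset (Fin t) := insert j ((Finset.univ.image e).erase (e l))
  have hcard : S.card = n := by
    rw [Finset.card_insert_of_notMem, Finset.card_erase_of_mem, Finset.card_image_of_injective _
      e.injective, Finset.card_univ, Fintype.card_fin]
    · have := l.2
      omega
    · simp
    · simp only [Finset.mem_erase, Finset.mem_image, Finset.mem_univ, true_and, not_and]
      exact fun _ h => hj h
  have hrow : Matrix.vecMul (N l) (A.submatrix id (S.orderEmbOfFin hcard)) = 0 := by
    ext m
    change (N * A) l (S.orderEmbOfFin hcard m) = 0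
    rcases Finset.mem_insert.1 (Finset.orderEmbOfFin_mem S hcard m) with h | h
    · rw [h, h0]
    · obtain ⟨hne, h⟩ := Finset.mem_erase.1 h
      obtain ⟨l', -, hl'⟩ := Finset.mem_image.1 h
      rw [← hl'] at hne ⊢
      have := congr_fun (congr_fun hN l) l'
      rw [Matrix.one_apply_ne fun h => hne (by rw [h])] at this
      exact this
  have hNl : N l = 0 := by
    apply Matrix.vecMul_injective_of_isUnit (hA.isUnit_submatrix (S.orderEmbOfFin hcard))
    exact hrow.trans (Matrix.zero_vecMul _).symm
  have h1 := congr_fun (congr_fun hN l) l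
  rw [Matrix.one_apply_eq, Matrix.mul_apply] at h1
  rw [Finset.sum_eq_zero fun x _ => by rw [hNl]; simp] at h1
  exact zero_ne_one h1

/-- Under hypothesis (H) the system can be solved for the powers of any `n` variables. -/
theorem HypH.exists_solvedPoly {A : Matrix (Fin n) (Fin t) F} (hA : HypH A) (d : Fin t → ℕ)
    (g : Fin n → MvPolynomial (Fin t) F) {S : Finset (Fin t)} (hS : S.card = n) :
    ∃ (c : Fin t → Fin t → F) (b : Fin t → MvPolynomial (Fin t) F),
      (∀ i ∈ S, ∀ j ∉ S, c i j ≠ 0) ∧ (∀ i, b i ∈ Submodule.span F (Set.range g)) ∧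
      Ideal.span (solvedPoly d S c b '' S) = Ideal.span (Set.range (sysPoly A d g)) := by
  classical
  let e := S.orderEmbOfFin hS
  have hrange : Set.range e = S := Finset.range_orderEmbOfFin S hS
  let N := (A.submatrix id e)⁻¹
  have hdet : IsUnit (A.submatrix id e).det :=
    (Matrix.isUnit_iff_isUnit_det _).1 (hA.isUnit_submatrix e)
  have hN : N * A.submatrix id e = 1 := Matrix.nonsing_inv_mul _ hdet
  have hN' : A.submatrix id e * N = 1 := Matrix.mul_nonsing_inv _ hdet
  let c : Fin t → Fin t → F := Function.extend e (N * A) 0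
  let b : Fin t → MvPolynomial (Fin t) F := Function.extend e (fun l => ∑ j, N l j • g j) 0
  have hc : ∀ l, c (e l) = (N * A) l := fun l => e.injective.extend_apply _ _ l
  have hb : ∀ l, b (e l) = ∑ j, N l j • g j := fun l => e.injective.extend_apply _ _ l
  have hf : ∀ l, solvedPoly d S c b (e l) = ∑ j, N l j • sysPoly A d g j := by
    intro l
    have h1 : ∑ j, N l j • sysPoly A d g j =
        ∑ i, C ((N * A) l i) * X i ^ d i - ∑ j, N l j • g j := by
      simp only [sysPoly, smul_sub, Finset.sum_sub_distrib]
      congr 1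
      simp only [Finset.smul_sum, smul_eq_C_mul]
      rw [Finset.sum_comm]
      refine Finset.sum_congr rfl fun i _ => ?_
      rw [Matrix.mul_apply, map_sum, Finset.sum_mul]
      refine Finset.sum_congr rfl fun j _ => ?_
      rw [C_mul, mul_assoc]
    rw [h1, solvedPoly, hc, hb, ← Finset.sum_add_sum_compl S]
    congr 2
    have h2 : S = Finset.univ.image e := by
      apply Finset.coe_injective
      rw [Finset.coe_image, Finset.coe_univ, Set.image_univ, hrange]
    have h3 : ∑ i ∈ S, C ((N * A) l i) * (X i : MvPolynomial (Fin t) F) ^ d i =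
        ∑ i ∈ Finset.univ.image e, C ((N * A) l i) * X i ^ d i := by rw [← h2]
    rw [h3, Finset.sum_image fun x _ y _ h => e.injective h, Finset.sum_eq_single l]
    · have : (N * A) l (e l) = 1 := by
        have := congr_fun (congr_fun hN l) l
        rwa [Matrix.one_apply_eq] at this
      rw [this, C_1, one_mul]
    · intro l' _ hl'
      have : (N * A) l (e l') = 0 := by
        have := congr_fun (congr_fun hN l) l'
        rwa [Matrix.one_apply_ne (Ne.symm hl')] at this
      rw [this, C_0, zero_mul]
    · exact fun h => absurd (Finset.mem_univ l) h
  refine ⟨c, b, ?_, ?_, ?_⟩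
  · intro i hi j hj
    obtain ⟨l, rfl⟩ : i ∈ Set.range e := hrange ▸ hi
    rw [hc]
    exact hA.mul_apply_ne_zero e hN l (hrange ▸ hj)
  · intro i
    by_cases hi : ∃ l, e l = i
    · obtain ⟨l, rfl⟩ := hi
      rw [hb]
      exact sum_mem fun j _ => Submodule.smul_mem _ _ (Submodule.subset_span ⟨j, rfl⟩)
    · simp only [b]
      rw [Function.extend_apply' _ _ _ hi]
      exact zero_mem _
  · apply le_antisymm
    · rw [Ideal.span_le]
      rintro _ ⟨i, hi, rfl⟩
      obtain ⟨l, rfl⟩ : i ∈ Set.range e := hrange ▸ hi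
      rw [hf]
      refine sum_mem fun j _ => ?_
      rw [smul_eq_C_mul]
      exact Ideal.mul_mem_left _ _ (Ideal.subset_span ⟨j, rfl⟩)
    · rw [Ideal.span_le]
      rintro _ ⟨j, rfl⟩
      have h1 : sysPoly A d g j = ∑ l, A j (e l) • solvedPoly d S c b (e l) := by
        simp only [hf, Finset.smul_sum, smul_smul]
        rw [Finset.sum_comm]
        simp only [← Finset.sum_smul]
        have h2 : ∀ y, ∑ x, A j (e x) * N x y = (1 : Matrix (Fin n) (Fin n) F) j y := fun y => by
          rw [← hN']
          rfl
        simp only [h2]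
        rw [Finset.sum_eq_single j]
        · rw [Matrix.one_apply_eq, one_smul]
        · intro j' _ hj'
          rw [Matrix.one_apply_ne (Ne.symm hj'), zero_smul]
        · exact fun h => absurd (Finset.mem_univ j) h
      rw [h1]
      refine sum_mem fun l _ => ?_
      rw [smul_eq_C_mul]
      exact Ideal.mul_mem_left _ _ (Ideal.subset_span ⟨e l, Finset.orderEmbOfFin_mem S hS l, rfl⟩)

variable {d : Fin t → ℕ} {g : Fin n → MvPolynomial (Fin t) F} {S : Finset (Fin t)}
  {c : Fin t → Fin t → F} {b : Fin t → MvPolynomial (Fin t) F}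

theorem mem_weightLT_of_mem_span (hg : ∀ j i, (g j).totalDegree < d i) {w : Fin t → ℕ}
    (hw : ∀ i, w i ≤ 1) {p : MvPolynomial (Fin t) F} (hp : p ∈ Submodule.span F (Set.range g))
    (i : Fin t) : p ∈ weightLT F w (d i) := by
  refine (Submodule.span_le (p := weightLT F w (d i))).2 ?_ hp
  rintro _ ⟨j, rfl⟩ e he
  refine lt_of_le_of_lt ?_ (hg j i)
  refine le_trans ?_ (le_totalDegree he)
  rw [Finsupp.weight_apply]
  exact Finset.sum_le_sum fun x _ => by
    simpa using Nat.mul_le_mul_left (e x) (hw x)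

theorem isTriangular_solvedPoly (hd : ∀ i, 0 < d i) (hg : ∀ j i, (g j).totalDegree < d i)
    (hb : ∀ i, b i ∈ Submodule.span F (Set.range g)) {w : Fin t → ℕ} (hw : ∀ i, w i ≤ 1)
    (hwS : ∀ i ∈ S, w i = 1) (hwc : ∀ i ∈ S, ∀ j ∉ S, w j * d j < d i) :
    IsTriangular w S d (solvedPoly d S c b) := by
  intro i hi
  refine ⟨hd i, ?_⟩
  have h1 : solvedPoly d S c b i - monomial (Finsupp.single i (d i)) 1 =
      ∑ j ∈ Sᶜ, C (c i j) * X j ^ d j - b i := by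
    rw [solvedPoly, ← X_pow_eq_monomial]
    ring
  rw [HasLead, h1, Finsupp.weight_single, hwS i hi, smul_eq_mul, mul_one]
  refine sub_mem (sum_mem fun j hj => ?_) (mem_weightLT_of_mem_span hg hw (hb i) i)
  have h2 := monomial_mem_weightLT (w := w) (Finsupp.single j (d j)) (c i j)
  rw [← C_mul_X_pow_eq_monomial] at h2
  refine weightLT_mono ?_ h2
  rw [Finsupp.weight_single, smul_eq_mul, mul_comm]
  exact hwc i hi j (Finset.mem_compl.1 hj)

theorem X_pow_sub_solvedPoly (i : Fin t) :
    X i ^ d i - solvedPoly d S c b i = b i - ∑ j ∈ Sᶜ, C (c i j) * X j ^ d j := by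
  rw [solvedPoly]
  ring

theorem X_pow_sub_solvedPoly_mem_supported {k : ℕ}
    (hg : ∀ j, g j ∈ supported F {i : Fin t | (i : ℕ) < k})
    (hb : ∀ i, b i ∈ Submodule.span F (Set.range g)) (hSk : ∀ i ∈ S, k ≤ (i : ℕ)) (i : Fin t) :
    X i ^ d i - solvedPoly d S c b i ∈ supported F ((S : Set (Fin t))ᶜ) := by
  rw [X_pow_sub_solvedPoly]
  refine sub_mem ?_ (sum_mem fun j hj => ?_)
  · have h1 : b i ∈ Subalgebra.toSubmodule (supported F {i : Fin t | (i : ℕ) < k}) := by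
      refine (Submodule.span_le (p := Subalgebra.toSubmodule _)).2 ?_ (hb i)
      rintro _ ⟨j, rfl⟩
      exact hg j
    refine supported_mono ?_ h1
    exact fun j hj hjS => absurd (hSk j hjS) (not_le.2 hj)
  · refine mul_mem (Subalgebra.algebraMap_mem _ _) (pow_mem ?_ _)
    exact X_mem_supported.2 (Finset.mem_compl.1 hj)

/-- The coefficient of `X j ^ d j` is `-c i j`, as `b i` has total degree below `d j`. -/
theorem X_pow_sub_solvedPoly_ne_zero (hd : ∀ i, 0 < d i) (hg : ∀ j i, (g j).totalDegree < d i)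
    (hb : ∀ i, b i ∈ Submodule.span F (Set.range g)) {i j : Fin t} (hj : j ∉ S)
    (hc : c i j ≠ 0) : X i ^ d i - solvedPoly d S c b i ≠ 0 := by
  classical
  rw [X_pow_sub_solvedPoly]
  intro h
  have h1 := congr_arg (coeff (Finsupp.single j (d j))) h
  rw [coeff_sub, coeff_sum, coeff_zero, Finset.sum_eq_single j] at h1
  · have h2 : coeff (Finsupp.single j (d j)) (b i) = 0 := by
      by_contra hne
      have := mem_weightLT_of_mem_span hg (w := fun _ => 1) (fun _ => le_rfl) (hb i) j
        (mem_support_iff.2 hne)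
      simp only [Set.mem_ofPred_eq, Finsupp.weight_single, smul_eq_mul, mul_one,
        lt_self_iff_false] at this
    rw [h2, zero_sub, neg_eq_zero, C_mul_X_pow_eq_monomial, coeff_monomial, if_pos rfl] at h1
    exact hc h1
  · intro j' _ hj'
    rw [C_mul_X_pow_eq_monomial, coeff_monomial, if_neg]
    intro h
    rw [Finsupp.single_eq_single_iff] at h
    rcases h with h | h
    · exact hj' h.1
    · exact (hd j').ne' h.1
  · exact fun h => absurd (Finset.mem_compl.2 hj) h

end Reduction

/-! ### The variety of a diagonal system -/

section Main

theorem card_filter_val_lt {t m : ℕ} (h : m ≤ t) :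
    (Finset.univ.filter fun i : Fin t => (i : ℕ) < m).card = m := by
  have h1 : (Finset.univ.filter fun i : Fin t => (i : ℕ) < m) =
      Finset.univ.image (Fin.castLE h) := by
    ext i
    simp only [Finset.mem_filter, Finset.mem_univ, true_and, Finset.mem_image]
    exact ⟨fun hi => ⟨⟨i, hi⟩, rfl⟩, by rintro ⟨j, rfl⟩; exact j.2⟩
  rw [h1, Finset.card_image_of_injective _ (Fin.castLE_injective h), Finset.card_univ,
    Fintype.card_fin]

theorem card_filter_le_val {t m : ℕ} (h : m ≤ t) :
    (Finset.univ.filter fun i : Fin t => m ≤ (i : ℕ)).card = t - m := by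
  have h1 := Finset.card_filter_add_card_filter_not (s := (Finset.univ : Finset (Fin t)))
    (fun i : Fin t => (i : ℕ) < m)
  simp only [not_lt, Finset.card_univ, Fintype.card_fin] at h1
  rw [card_filter_val_lt h] at h1
  omega

theorem natCard_notMem {t : ℕ} (S : Finset (Fin t)) :
    Nat.card {i // i ∉ S} = t - S.card := by
  rw [Nat.card_eq_fintype_card, Fintype.card_subtype_compl, Fintype.card_fin, Fintype.card_coe]

variable {F : Type*} [Field F] {n t : ℕ}

/-- The hypotheses on a diagonal system, common to both cases of the theorem. -/
structure SystemHyp (k : ℕ) (A : Matrix (Fin n) (Fin t) F) (d : Fin t → ℕ)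
    (g : Fin n → MvPolynomial (Fin t) F) : Prop where
  one_le : 1 ≤ k
  le_n : k ≤ n
  le_t : n + k + 1 ≤ t
  anti : StrictAnti d
  pos : ∀ i, 0 < d i
  ne_zero : ∀ i, (d i : F) ≠ 0
  hypH : HypH A
  supp : ∀ j, g j ∈ supported F {i : Fin t | (i : ℕ) < k}
  totalDegree_lt : ∀ j i, (g j).totalDegree < d i

variable {k : ℕ} {A : Matrix (Fin n) (Fin t) F} {d : Fin t → ℕ}
  {g : Fin n → MvPolynomial (Fin t) F}

theorem sysIdeal_eq_map (K : Type*) [Field K] [Algebra F K] :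
    sysIdeal K A d g =
      (Ideal.span (Set.range (sysPoly A d g))).map (map (algebraMap F K)) := by
  rw [Ideal.map_span, ← Set.range_comp]
  rfl

theorem sysVariety_eq_zeroLocus (K : Type*) [Field K] [Algebra F K] (Ω : Type*) [Field Ω]
    [Algebra F Ω] [Algebra K Ω] [IsScalarTower F K Ω] :
    sysVariety Ω A d g = zeroLocus Ω (sysIdeal K A d g) := by
  rw [sysIdeal, zeroLocus_span]
  ext x
  simp only [sysVariety, Set.mem_ofPred_eq, Set.forall_mem_range, aeval_map_algebraMap]

namespace SystemHyp

variable (K : Type*) [Field K] [Algebra F K]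

theorem exists_isTriangular (h : SystemHyp k A d g)
    {S : Finset (Fin t)} (hS : S.card = n) {w : Fin t → ℕ}
    (hw : ∀ i, w i ≤ 1) (hwS : ∀ i ∈ S, w i = 1) (hwc : ∀ i ∈ S, ∀ j ∉ S, w j * d j < d i) :
    ∃ f : Fin t → MvPolynomial (Fin t) K,
      IsTriangular w S d f ∧ Ideal.span (f '' S) = sysIdeal K A d g := by
  obtain ⟨c, b, -, hb, hspan⟩ := h.hypH.exists_solvedPoly d g hS
  refine ⟨_, (isTriangular_solvedPoly (c := c) h.pos h.totalDegree_lt hb hw hwS hwc).map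
    (algebraMap F K), ?_⟩
  rw [sysIdeal_eq_map, ← hspan, Ideal.map_span, Set.image_image]

theorem exists_isTriangular_first (h : SystemHyp k A d g) :
    ∃ f : Fin t → MvPolynomial (Fin t) K,
      IsTriangular (fun _ => 1) (Finset.univ.filter fun i : Fin t => (i : ℕ) < n) d f ∧
        Ideal.span (f '' (Finset.univ.filter fun i : Fin t => (i : ℕ) < n : Finset (Fin t))) =
          sysIdeal K A d g := by
  refine h.exists_isTriangular K (card_filter_val_lt (by have := h.le_t; omega))
    (fun _ => le_rfl) (fun _ _ => rfl) fun i hi j hj => ?_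
  rw [one_mul]
  refine h.anti (Fin.lt_def.2 ?_)
  simp only [Finset.mem_filter, Finset.mem_univ, true_and] at hi hj
  omega

theorem natCard_first (h : SystemHyp k A d g) :
    Nat.card {i // i ∉ Finset.univ.filter fun i : Fin t => (i : ℕ) < n} = t - n := by
  rw [natCard_notMem, card_filter_val_lt (by have := h.le_t; omega)]

theorem nonempty_first (h : SystemHyp k A d g) :
    Nonempty {i // i ∉ Finset.univ.filter fun i : Fin t => (i : ℕ) < n} := by
  have h1 := h.natCard_first
  have := h.le_t
  exact (Nat.card_pos_iff.1 (by omega)).1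

variable (Ω : Type*) [Field Ω] [Algebra F Ω] [Algebra K Ω] [IsScalarTower F K Ω] [IsAlgClosed Ω]

/-- The polynomials of the system generate the defining ideal of its variety. -/
theorem vanishingIdeal_sysVariety (h : SystemHyp k A d g) :
    vanishingIdeal K (sysVariety Ω A d g) = sysIdeal K A d g := by
  classical
  rw [sysVariety_eq_zeroLocus K]
  refine le_antisymm ?_ (le_vanishingIdeal_zeroLocus _)
  have hle := h.le_t
  -- `n + k ≤ t` leaves room for `S` among the variables absent from every `g j`, so the right-hand
  -- sides involve only free variables.
  obtain ⟨S, hSk, hS⟩ := Finset.exists_subset_card_eq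
    (s := Finset.univ.filter fun i : Fin t => k ≤ (i : ℕ)) (n := n)
    (by rw [card_filter_le_val (by omega)]; omega)
  have hSk' : ∀ i ∈ S, k ≤ (i : ℕ) := fun i hi => (Finset.mem_filter.1 (hSk hi)).2
  obtain ⟨c, b, hc, hb, hspan⟩ := h.hypH.exists_solvedPoly d g hS
  have htri := (isTriangular_solvedPoly (S := S) (c := c) h.pos h.totalDegree_lt hb
    (w := fun i => if i ∈ S then 1 else 0) (fun i => by split_ifs <;> simp)
    (fun i hi => if_pos hi)
    (fun i _ j hj => by rw [if_neg hj, zero_mul]; exact h.pos i)).map (algebraMap F K)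
  have heq : Ideal.span ((fun i => MvPolynomial.map (algebraMap F K) (solvedPoly d S c b i)) ''
      (S : Set (Fin t))) = sysIdeal K A d g := by
    rw [sysIdeal_eq_map, ← hspan, Ideal.map_span, Set.image_image]
  have hu : ∀ i, (X i ^ d i - MvPolynomial.map (algebraMap F K) (solvedPoly d S c b i) :
      MvPolynomial (Fin t) K) =
      MvPolynomial.map (algebraMap F K) (X i ^ d i - solvedPoly d S c b i) := fun i => by
    rw [map_sub, map_pow, map_X]
  rw [← heq]
  refine htri.vanishingIdeal_le ?_ ?_ ?_
  · intro i _
    have := (map_ne_zero (algebraMap F Ω)).2 (h.ne_zero i)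
    rwa [map_natCast] at this
  · intro i _
    rw [hu, mem_supported]
    exact (Finset.coe_subset.2 (vars_map _ _)).trans
      (mem_supported.1 (X_pow_sub_solvedPoly_mem_supported h.supp hb hSk' i))
  · intro i hi
    rw [hu]
    obtain ⟨j, hj⟩ : ∃ j, j ∉ S := by
      by_contra! hcon
      have : S = Finset.univ := Finset.eq_univ_of_forall hcon
      rw [this, Finset.card_univ, Fintype.card_fin] at hS
      omega
    intro h0
    refine X_pow_sub_solvedPoly_ne_zero h.pos h.totalDegree_lt hb hj (hc i hi j hj) ?_
    exact map_injective _ (algebraMap F K).injective (h0.trans (map_zero _).symm)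

theorem dim_component (h : SystemHyp k A d g)
    {C : Set (Fin t → Ω)} (hC : C ∈ components K (sysVariety Ω A d g)) :
    dim K C = ((t - n : ℕ) : WithBot ℕ∞) := by
  obtain ⟨f, hf, hspan⟩ := h.exists_isTriangular_first K
  rw [sysVariety_eq_zeroLocus K, ← hspan] at hC
  rw [hf.dim_component hC, h.natCard_first]

theorem le_dim_sysVariety (h : SystemHyp k A d g)
    : ((t - n : ℕ) : WithBot ℕ∞) ≤ dim K (sysVariety Ω A d g) := by
  obtain ⟨f, hf, hspan⟩ := h.exists_isTriangular_first K
  obtain ⟨P, hP⟩ := Ideal.nonempty_minimalPrimes (hspan ▸ hf.span_ne_top)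
  have hC := zeroLocus_mem_components (Ω := Ω) hP
  rw [← sysVariety_eq_zeroLocus] at hC
  rw [← h.dim_component K Ω hC]
  exact dim_mono (show Maximal (fun W => IsIrredVariety K W ∧ W ⊆ sysVariety Ω A d g) _
    from hC).prop.2

theorem dimAt_eq (h : SystemHyp k A d g) {x : Fin t → Ω} (hx : x ∈ sysVariety Ω A d g) :
    dimAt K (sysVariety Ω A d g) x = ((t - n : ℕ) : WithBot ℕ∞) := by
  refine le_antisymm (iSup₂_le fun C hC => (h.dim_component K Ω hC.1).le) ?_
  obtain ⟨C, hC, hxC⟩ := exists_mem_components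
    (show x ∈ zeroLocus Ω (sysIdeal K A d g) by rwa [← sysVariety_eq_zeroLocus])
  rw [← sysVariety_eq_zeroLocus] at hC
  rw [← h.dim_component K Ω hC]
  exact le_iSup₂_of_le C ⟨hC, hxC⟩ le_rfl

theorem isCompleteIntersection (h : SystemHyp k A d g)
    : IsCompleteIntersection K (sysVariety Ω A d g) n := by
  classical
  have hle := h.le_t
  have hnt : n ≤ t := by omega
  refine ⟨?_, fun C hC => ?_, _, h.vanishingIdeal_sysVariety K Ω⟩
  · obtain ⟨f, hf, hspan⟩ := h.exists_isTriangular_first K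
    have hrange : Set.range (fun l : Fin n => f (Fin.castLE hnt l)) =
        f '' (Finset.univ.filter fun i : Fin t => (i : ℕ) < n : Finset (Fin t)) := by
      ext p
      simp only [Set.mem_range, Set.mem_image, Finset.coe_filter, Finset.mem_univ, true_and,
        Set.mem_ofPred_eq]
      exact ⟨fun ⟨l, hl⟩ => ⟨_, l.2, hl⟩, fun ⟨i, hi, hl⟩ => ⟨⟨i, hi⟩, hl⟩⟩
    refine ⟨fun l => f (Fin.castLE hnt l), ⟨⟨fun i hi => ?_⟩, ?_⟩, ?_⟩
    · rw [List.length_ofFn] at hi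
      have hprev : Ideal.ofList ((List.ofFn fun l => f (Fin.castLE hnt l)).take i) =
          Ideal.span (f '' (Finset.univ.filter fun j : Fin t => (j : ℕ) < i :
            Finset (Fin t))) := by
        rw [Ideal.ofList]
        congr 1
        ext p
        simp only [Set.mem_ofPred_eq, List.mem_take_iff_getElem, List.getElem_ofFn,
          List.length_ofFn, Set.mem_image, Finset.coe_filter, Finset.mem_univ, true_and]
        constructor
        · rintro ⟨m, hm, rfl⟩
          exact ⟨_, (by simp; omega), rfl⟩
        · rintro ⟨j, hj, rfl⟩
          exact ⟨j, by omega, rfl⟩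
      rw [isSMulRegular_quotient_iff_mem_of_smul_mem, hprev, smul_eq_mul, Ideal.mul_top,
        List.getElem_ofFn]
      intro p hp
      refine hf.mem_of_apply_mul_mem (fun j hj => ?_) ?_ ?_ hp
      · simp only [Finset.mem_filter, Finset.mem_univ, true_and] at hj ⊢
        omega
      · simpa using hi
      · simp
    · have htop : Ideal.ofList (List.ofFn fun l => f (Fin.castLE hnt l)) =
          sysIdeal K A d g := by
        rw [← hspan, ← hrange, Ideal.ofList]
        congr 1
        ext p
        simp [List.mem_ofFn]
      rw [htop, smul_eq_mul, Ideal.mul_top, ← hspan]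
      exact hf.span_ne_top.symm
    · rw [hrange, hspan, sysVariety_eq_zeroLocus K]
  · rw [h.dim_component K Ω hC, Fintype.card_fin]
    norm_cast
    omega

/-- The partial derivatives of the system in the variables that do not occur in the `g j`. -/
theorem aeval_pderiv_sysPoly (h : SystemHyp k A d g)
    (x : Fin t → Ω) (j : Fin n) {i : Fin t} (hi : k ≤ (i : ℕ)) :
    aeval x (pderiv i (sysPoly A d g j)) =
      algebraMap F Ω (A j i) * (d i * x i ^ (d i - 1)) := by
  have hgi : pderiv i (g j) = 0 := by
    refine pderiv_eq_zero_of_notMem_vars fun hv => ?_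
    have := mem_supported.1 (h.supp j) hv
    exact absurd hi (not_le.2 this)
  rw [sysPoly, map_sub, hgi, sub_zero, map_sum, Finset.sum_eq_single i]
  · rw [pderiv_C_mul, pderiv_pow, pderiv_X_self, mul_one, map_mul, aeval_C, map_mul,
      map_natCast, map_pow, aeval_X]
  · intro i' _ hi'
    rw [pderiv_C_mul, pderiv_pow, pderiv_X_of_ne hi', mul_zero, mul_zero]
  · exact fun h => absurd (Finset.mem_univ i) h

/-- Choose `n` nonzero coordinates of index at least `k`. The corresponding minor of the Jacobian is
that of `A` with columns scaled by `d i * x i ^ (d i - 1) ≠ 0`, so the Jacobian has rank `n`. -/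
theorem finrank_tangentSpace (h : SystemHyp k A d g)
    [DecidableEq Ω] {x : Fin t → Ω} (hx : x ∈ sysVariety Ω A d g)
    (hcard : n ≤ (Finset.univ.filter fun i : Fin t => k ≤ (i : ℕ) ∧ x i ≠ 0).card) :
    Module.finrank Ω (tangentSpace K (sysVariety Ω A d g) x) = t - n := by
  classical
  let J : (Fin t → Ω) →ₗ[Ω] (Fin n → Ω) :=
    (Matrix.of fun j i => aeval x (pderiv i (sysPoly A d g j)) : Matrix (Fin n) (Fin t) Ω).mulVecLin
  have hJ : ∀ v j, J v j = ∑ i, aeval x (pderiv i (sysPoly A d g j)) * v i := fun v j => rfl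
  have hker : tangentSpace K (sysVariety Ω A d g) x = LinearMap.ker J := by
    ext v
    rw [LinearMap.mem_ker]
    constructor
    · intro hv
      ext j
      rw [hJ, Pi.zero_apply]
      have := hv (map (algebraMap F K) (sysPoly A d g j)) (by
        rw [h.vanishingIdeal_sysVariety K Ω]
        exact Ideal.subset_span ⟨j, rfl⟩)
      simpa only [pderiv_map, aeval_map_algebraMap] using this
    · intro hv p hp
      rw [h.vanishingIdeal_sysVariety K Ω] at hp
      have hx' : x ∈ zeroLocus Ω (sysIdeal K A d g) := by rwa [← sysVariety_eq_zeroLocus]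
      refine Submodule.span_induction (p := fun p _ => ∑ i, aeval x (pderiv i p) * v i = 0)
        ?_ ?_ ?_ ?_ hp
      · rintro _ ⟨j, rfl⟩
        simp only [pderiv_map, aeval_map_algebraMap]
        rw [← hJ, hv, Pi.zero_apply]
      · simp
      · intro p q _ _ hp hq
        simp only [map_add, add_mul, Finset.sum_add_distrib, hp, hq, add_zero]
      · intro a p hp hp0
        have hpx : aeval x p = 0 := hx' p hp
        have : ∀ i, aeval x (pderiv i (a • p)) * v i = aeval x a * (aeval x (pderiv i p) * v i) := by
          intro i
          rw [smul_eq_mul, pderiv_mul, map_add, map_mul, map_mul, hpx]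
          ring
        simp only [this, ← Finset.mul_sum, hp0, mul_zero]
  have hsurj : LinearMap.range J = ⊤ := by
    rw [LinearMap.range_eq_top]
    intro y
    obtain ⟨S, hSsub, hS⟩ := Finset.exists_subset_card_eq hcard
    let e := S.orderEmbOfFin hS
    have he : ∀ l, k ≤ (e l : ℕ) ∧ x (e l) ≠ 0 := fun l =>
      (Finset.mem_filter.1 (hSsub (Finset.orderEmbOfFin_mem S hS l))).2
    have hunit : IsUnit ((A.submatrix id e).map (algebraMap F Ω)) :=
      (h.hypH.isUnit_submatrix e).map (algebraMap F Ω).mapMatrix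
    obtain ⟨z, hz⟩ := Matrix.mulVec_surjective_iff_isUnit.2 hunit y
    let D : Fin n → Ω := fun l => (d (e l) : Ω) * x (e l) ^ (d (e l) - 1)
    have hD : ∀ l, D l ≠ 0 := by
      intro l
      refine mul_ne_zero ?_ (pow_ne_zero _ (he l).2)
      have := (map_ne_zero (algebraMap F Ω)).2 (h.ne_zero (e l))
      rwa [map_natCast] at this
    refine ⟨Function.extend e (fun l => z l / D l) 0, ?_⟩
    ext j
    rw [hJ, ← Finset.sum_subset (Finset.subset_univ (Finset.univ.image e)),
      Finset.sum_image fun a _ b _ hab => e.injective hab, ← hz]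
    · change _ = ∑ l : Fin n, algebraMap F Ω (A j (e l)) * z l
      refine Finset.sum_congr rfl fun l _ => ?_
      rw [e.injective.extend_apply, h.aeval_pderiv_sysPoly Ω x j (he l).1]
      change _ * D l * _ = algebraMap F Ω (A j (e l)) * z l
      have := hD l
      field_simp
    · intro i _ hi
      rw [Function.extend_apply', Pi.zero_apply, mul_zero]
      rintro ⟨l, rfl⟩
      exact hi (Finset.mem_image_of_mem _ (Finset.mem_univ l))
  have hrn := LinearMap.finrank_range_add_finrank_ker J
  rw [hsurj, finrank_top, Module.finrank_fin_fun, Module.finrank_fin_fun] at hrn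
  rw [hker]
  omega

/-- The section of the variety with the coordinate subspace `X i = 0`, `i ∈ Z`, has the expected
dimension. -/
theorem ringKrullDim_section_le (h : SystemHyp k A d g)
    {Z : Finset (Fin t)} (hZk : ∀ i ∈ Z, k ≤ (i : ℕ))
    (hZ : Z.card + n + k = t + 1) :
    ringKrullDim (MvPolynomial (Fin t) K ⧸
      (sysIdeal K A d g ⊔ Ideal.span (X '' (Z : Set (Fin t))))) ≤ ((k - 1 : ℕ) : WithBot ℕ∞) := by
  classical
  have hk := h.one_le
  have hkn := h.le_n
  have hle := h.le_t
  -- With `S` disjoint from `Z`, adjoining the `X i`, `i ∈ Z`, as equations of exponent `1` keeps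
  -- the system triangular. It then has `n + Z.card = t + 1 - k` members.
  obtain ⟨S, hSk, hSZ, hS⟩ := Finset.exists_subsuperset_card_eq
    (s := Finset.univ.filter fun i : Fin t => (i : ℕ) < k) (t := Zᶜ) (n := n)
    (fun i hi => Finset.mem_compl.2 fun hiZ => by
      have := hZk i hiZ
      have := (Finset.mem_filter.1 hi).2
      omega)
    (by rw [card_filter_val_lt (by omega)]; exact hkn)
    (by rw [Finset.card_compl, Fintype.card_fin]; omega)
  have hdisj : Disjoint S Z := Finset.disjoint_left.2 fun i hi => Finset.mem_compl.1 (hSZ hi)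
  obtain ⟨f, hf, hspan⟩ := h.exists_isTriangular K hS (w := fun i => if i ∈ S then 1 else 0)
    (fun i => by split_ifs <;> simp) (fun i hi => if_pos hi)
    (fun i _ j hj => by rw [if_neg hj, zero_mul]; exact h.pos i)
  have hf' : IsTriangular (fun i => if i ∈ S then 1 else 0) (S ∪ Z)
      (fun i => if i ∈ S then d i else 1) (fun i => if i ∈ S then f i else X i) := by
    intro i hi
    by_cases hiS : i ∈ S
    · simpa only [if_pos hiS] using hf i hiS
    · simp only [if_neg hiS]
      exact ⟨one_pos, hasLead_monomial _⟩
  have hInt := hf'.paramMap_isIntegral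
    (J := sysIdeal K A d g ⊔ Ideal.span (X '' (Z : Set (Fin t)))) (by
      rw [Ideal.span_le]
      rintro _ ⟨i, hi, rfl⟩
      by_cases hiS : i ∈ S
      · simp only [if_pos hiS]
        refine Ideal.mem_sup_left ?_
        rw [← hspan]
        exact Ideal.subset_span ⟨i, hiS, rfl⟩
      · simp only [if_neg hiS]
        refine Ideal.mem_sup_right (Ideal.subset_span ⟨i, ?_, rfl⟩)
        exact (Finset.mem_union.1 hi).resolve_left hiS)
  refine (ringKrullDim_quotient_le hInt).trans ?_
  rw [natCard_notMem, Finset.card_union_of_disjoint hdisj, hS]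
  norm_cast
  omega

theorem dim_singularLocus_le (h : SystemHyp k A d g) :
    dim K (singularLocus K (sysVariety Ω A d g)) ≤ ((k - 1 : ℕ) : WithBot ℕ∞) := by
  classical
  have hle := h.le_t
  refine dim_le_of_subset_biUnion
    ((Finset.univ.filter fun i : Fin t => k ≤ (i : ℕ)).powersetCard (t + 1 - n - k))
    (fun Z => sysIdeal K A d g ⊔ Ideal.span (X '' (Z : Set (Fin t)))) ?_ ?_
  · rintro x ⟨hxV, hx⟩
    rw [h.dimAt_eq K Ω hxV] at hx
    have hlt : (Finset.univ.filter fun i : Fin t => k ≤ (i : ℕ) ∧ x i ≠ 0).card < n := by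
      by_contra! hcon
      exact hx (by rw [h.finrank_tangentSpace K Ω hxV hcon])
    have hsplit := Finset.card_filter_add_card_filter_not
      (s := Finset.univ.filter fun i : Fin t => k ≤ (i : ℕ)) (fun i => x i ≠ 0)
    rw [Finset.filter_filter, card_filter_le_val (by omega)] at hsplit
    obtain ⟨Z, hZsub, hZ⟩ := Finset.exists_subset_card_eq
      (s := (Finset.univ.filter fun i : Fin t => k ≤ (i : ℕ)).filter fun i => ¬ x i ≠ 0)
      (n := t + 1 - n - k) (by omega)
    refine Set.mem_iUnion₂.2 ⟨Z, Finset.mem_powersetCard.2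
      ⟨hZsub.trans (Finset.filter_subset _ _), hZ⟩, ?_⟩
    rw [zeroLocus_sup, zeroLocus_span, ← sysVariety_eq_zeroLocus]
    refine ⟨hxV, ?_⟩
    rintro _ ⟨i, hi, rfl⟩
    rw [aeval_X]
    exact not_not.1 (Finset.mem_filter.1 (hZsub hi)).2
  · intro Z hZ
    obtain ⟨hZsub, hZc⟩ := Finset.mem_powersetCard.1 hZ
    exact h.ringKrullDim_section_le K (fun i hi => (Finset.mem_filter.1 (hZsub hi)).2) (by omega)

/-- The inequality `(k - 1) + 2 ≤ t - n` is exactly `n + k + 1 ≤ t`. -/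
theorem dim_singularLocus_add_two_le (h : SystemHyp k A d g) :
    dim K (singularLocus K (sysVariety Ω A d g)) + 2 ≤ dim K (sysVariety Ω A d g) := by
  refine le_trans ?_ (h.le_dim_sysVariety K Ω)
  refine (add_le_add_left (h.dim_singularLocus_le K Ω) 2).trans ?_
  have h1 := h.le_t
  have h2 := h.one_le
  norm_cast
  omega

theorem deg_le (h : SystemHyp k A d g) [Algebra.IsAlgebraic K Ω] :
    deg K (sysVariety Ω A d g) ≤
      ((∏ i ∈ Finset.univ.filter fun i : Fin t => (i : ℕ) < n, d i : ℕ) : ℕ∞) := by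
  obtain ⟨f, hf, hspan⟩ := h.exists_isTriangular_first K
  have := h.nonempty_first
  rw [sysVariety_eq_zeroLocus K, ← hspan]
  exact hf.deg_le

end SystemHyp

end Main

/-! ### Row echelon forms -/

section RowEchelon

variable {F : Type*} [Field F] {n t : ℕ} {A : Matrix (Fin n) (Fin t) F}

theorem HypH.exists_isRowEchelon (hA : HypH A) (hnt : n ≤ t) :
    ∃ (M : Matrix (Fin n) (Fin n) F) (i : Fin n → Fin t),
      IsUnit M.det ∧ IsRowEchelon (M * A) i := by
  have hdet : IsUnit (A.submatrix id (Fin.castLEOrderEmb hnt)).det :=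
    (Matrix.isUnit_iff_isUnit_det _).1 (hA.isUnit_submatrix _)
  have hmul := Matrix.nonsing_inv_mul _ hdet
  refine ⟨(A.submatrix id (Fin.castLEOrderEmb hnt))⁻¹, Fin.castLE hnt,
    Matrix.isUnit_nonsing_inv_det _ hdet, Fin.strictMono_castLE hnt, fun j => ⟨?_, fun l hl => ?_⟩⟩
  · have := congr_fun (congr_fun hmul j) j
    rw [Matrix.one_apply_eq] at this
    exact fun h => one_ne_zero (this.symm.trans h)
  · have hln : (l : ℕ) < n := lt_trans (Fin.lt_def.1 hl) j.2
    have := congr_fun (congr_fun hmul j) ⟨l, hln⟩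
    rw [Matrix.one_apply_ne (fun h => by rw [h] at hl; exact lt_irrefl _ hl)] at this
    exact this

theorem HypH.prod_pivots (hA : HypH A) (hnt : n ≤ t) (d : Fin t → ℕ)
    {M : Matrix (Fin n) (Fin n) F} {i : Fin n → Fin t} (hM : IsUnit M.det)
    (hi : IsRowEchelon (M * A) i) :
    ∏ j, d (i j) = ∏ l ∈ Finset.univ.filter fun l : Fin t => (l : ℕ) < n, d l := by
  classical
  have hlt : ∀ j, (i j : ℕ) < n := by
    intro j
    by_contra! hj
    have hpos : 0 < n := j.pos
    -- If some pivot lies beyond the first `n` columns, so does the last one, and the last row of `M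
    -- * A` is zero on the first block, which is invertible.
    let m : Fin n := ⟨n - 1, by omega⟩
    have hjm : j ≤ m := Fin.le_def.2 (by simp only [m]; omega)
    have him : n ≤ (i m : ℕ) := hj.trans (hi.1.monotone hjm)
    have hunit : IsUnit (M * A.submatrix id (Fin.castLEOrderEmb hnt)).det := by
      rw [Matrix.det_mul]
      exact hM.mul ((Matrix.isUnit_iff_isUnit_det _).1 (hA.isUnit_submatrix _))
    refine hunit.ne_zero (Matrix.det_eq_zero_of_row_eq_zero m fun l => ?_)
    exact (hi.2 m).2 (Fin.castLE hnt l) (Fin.lt_def.2 (lt_of_lt_of_le l.2 him))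
  have himg : Finset.univ.image i = Finset.univ.filter fun l : Fin t => (l : ℕ) < n := by
    apply Finset.eq_of_subset_of_card_le
    · intro l hl
      obtain ⟨j, -, rfl⟩ := Finset.mem_image.1 hl
      exact Finset.mem_filter.2 ⟨Finset.mem_univ _, hlt j⟩
    · rw [card_filter_val_lt hnt, Finset.card_image_of_injective _ hi.1.injective,
        Finset.card_univ, Fintype.card_fin]
  rw [← himg, Finset.prod_image fun a _ b _ hab => hi.1.injective hab]

end RowEchelon

end DiagonalSystem

end

theorem mainTheorem9
    {F : Type*} [Field F] [Finite F]
    {Ω : Type*} [Field Ω] [Algebra F Ω] [IsAlgClosure F Ω]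
    (K : Type*) [Field K] [Algebra F K] [Algebra K Ω] [IsScalarTower F K Ω]
    (t n k : ℕ) (hk : 1 ≤ k) (hkn : k ≤ n)
    (d : Fin t → ℕ) (hd : StrictAnti d) (hd2 : ∀ i, 2 ≤ d i)
    (hchar : ∀ i, ¬ ringChar F ∣ d i)
    (A : Matrix (Fin n) (Fin t) F) (hA : DiagonalSystem.HypH A)
    (g : Fin n → MvPolynomial (Fin t) F)
    (hg : ∀ j, g j ∈ MvPolynomial.supported F {i : Fin t | (i : ℕ) < k})
    (hcase :
      ((∀ j, ∃ c : F, g j = MvPolynomial.C c) ∧ n + 2 ≤ t) ∨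
      ((∀ j i, (g j).totalDegree < d i) ∧ (∃ j, 0 < (g j).totalDegree) ∧ 2 * n + 1 ≤ t)) :
    -- the ideal `(f_1, …, f_n)` is radical
    (DiagonalSystem.sysIdeal K A d g).IsRadical ∧
    -- the singular locus of `V` has codimension at least two in `V`
    DiagonalSystem.dim K (DiagonalSystem.singularLocus K (DiagonalSystem.sysVariety Ω A d g)) + 2
      ≤ DiagonalSystem.dim K (DiagonalSystem.sysVariety Ω A d g) ∧
    -- `V` is a complete intersection of codimension `n`
    DiagonalSystem.IsCompleteIntersection K (DiagonalSystem.sysVariety Ω A d g) n ∧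
    -- `A` has a row echelon form, and the degree of `V` is at most the product of the
    -- exponents at its pivots
    (∃ (M : Matrix (Fin n) (Fin n) F) (i : Fin n → Fin t),
      IsUnit M.det ∧ DiagonalSystem.IsRowEchelon (M * A) i) ∧
    ∀ (M : Matrix (Fin n) (Fin n) F) (i : Fin n → Fin t),
      IsUnit M.det → DiagonalSystem.IsRowEchelon (M * A) i →
        DiagonalSystem.deg K (DiagonalSystem.sysVariety Ω A d g) ≤ ((∏ j, d (i j) : ℕ) : ℕ∞) := by
  have hne : ∀ i, (d i : F) ≠ 0 := fun i h0 => hchar i ((ringChar.spec F (d i)).1 h0)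
  have hpos : ∀ i, 0 < d i := fun i => lt_of_lt_of_le two_pos (hd2 i)
  obtain ⟨k', h⟩ : ∃ k', DiagonalSystem.SystemHyp k' A d g := by
    rcases hcase with ⟨hc, ht⟩ | ⟨hdeg, -, ht⟩
    -- Constants involve no variable, so `1` can play the role of `k`, and `n + 2 ≤ t` is the
    -- required bound. In the other case it follows from `k ≤ n` and `2 * n + 1 ≤ t`.
    · refine ⟨1, le_rfl, hk.trans hkn, ht, hd, hpos, hne, hA, fun j => ?_, fun j i => ?_⟩
      · obtain ⟨c, hc⟩ := hc j
        rw [hc]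
        exact Subalgebra.algebraMap_mem _ c
      · obtain ⟨c, hc⟩ := hc j
        rw [hc, MvPolynomial.totalDegree_C]
        exact hpos i
    · exact ⟨k, hk, hkn, by omega, hd, hpos, hne, hA, hg, hdeg⟩
  have hnt : n ≤ t := by
    have := h.le_t
    omega
  have : IsAlgClosed Ω := IsAlgClosure.isAlgClosed F
  have : Algebra.IsAlgebraic F Ω := IsAlgClosure.isAlgebraic
  have : Algebra.IsAlgebraic K Ω := Algebra.IsAlgebraic.tower_top (K := F) K
  refine ⟨?_, h.dim_singularLocus_add_two_le K Ω, h.isCompleteIntersection K Ω,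
    hA.exists_isRowEchelon hnt, fun M i hM hi => ?_⟩
  -- The ideal equals the vanishing ideal of its own zero locus, which by the Nullstellensatz is a
  -- radical.
  · rw [← h.vanishingIdeal_sysVariety K Ω, DiagonalSystem.sysVariety_eq_zeroLocus K,
      MvPolynomial.vanishingIdeal_zeroLocus_eq_radical]
    exact Ideal.radical_isRadical _
  · rw [hA.prod_pivots hnt d hM hi]
    exact h.deg_le K Ω
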